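/- In the problem Conflict-Free Cut, an instance is a pair $(G,\hat G)$, where $G$ is a finite simple connected graph and $\hat G$ (the conflict graph) is a simple graph with vertex set $V(\hat G)=E(G)$; the question is whether there is a set $F\subseteq E(G)$ such that $G-F$ is disconnected and $F$ is an independent set of $\hat G$. Theorem. Conflict-Free Cut is fixed-parameter tractable with the vertex cover number $k$ of $G$ as the parameter. More precisely, there is an algorithm that decides every instance $(G,\hat G)$ in time $2^k\cdot n^{O(1)}$, where $n=|V(G)|$ and $k$ is the minimum cardinality of a vertex cover of $G$. (Running times are counted on a unit-cost random access machine with addition and subtraction; the input consists of $n$ in unary and the adjacency matrices of $G$ and $\hat G$, and $k$ is not part of the input.) -/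

import Mathlib

/-! ### Random access machines

A random access machine has registers `reg 0, reg 1, …` and a memory `mem 0, mem 1, …`, all
holding natural numbers. A program is written with the usual structured control flow; every
elementary instruction and every evaluation of a branching condition is one step. Addition and
truncated subtraction are the only arithmetic operations (there is no multiplication). -/

namespace RAM

/-- Programs. A program mentions only finitely many registers. -/
inductive Program : Type
  /-- do nothing -/
  | skip : Program
  /-- `reg r := c` -/
  | const (r c : ℕ) : Program
  /-- `reg r := reg a + reg b` -/
  | add (r a b : ℕ) : Program
  /-- `reg r := reg a - reg b`, truncated at `0` -/
  | sub (r a b : ℕ) : Program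
  /-- `reg r := mem (reg a)` -/
  | load (r a : ℕ) : Program
  /-- `mem (reg a) := reg b` -/
  | store (a b : ℕ) : Program
  /-- first `P`, then `Q` -/
  | seq (P Q : Program) : Program
  /-- if `reg r ≠ 0` then `P` else `Q` -/
  | cond (r : ℕ) (P Q : Program) : Program
  /-- while `reg r ≠ 0` do `P` -/
  | loop (r : ℕ) (P : Program) : Program

/-- The contents of the registers and of the memory. -/
@[ext] structure State : Type where
  reg : ℕ → ℕ
  mem : ℕ → ℕ

/-- Write the value `v` into register `r`. -/
def State.setReg (s : State) (r v : ℕ) : State :=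
  { s with reg := Function.update s.reg r v }

/-- Write the value `v` into memory cell `a`. -/
def State.setMem (s : State) (a v : ℕ) : State :=
  { s with mem := Function.update s.mem a v }

/-- `Runs P s s' t`: the program `P`, started in the state `s`, halts in the state `s'` after
exactly `t` steps. -/
inductive Runs : Program → State → State → ℕ → Prop
  | skip (s : State) : Runs .skip s s 1
  | const (r c : ℕ) (s : State) : Runs (.const r c) s (s.setReg r c) 1
  | add (r a b : ℕ) (s : State) : Runs (.add r a b) s (s.setReg r (s.reg a + s.reg b)) 1
  | sub (r a b : ℕ) (s : State) : Runs (.sub r a b) s (s.setReg r (s.reg a - s.reg b)) 1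
  | load (r a : ℕ) (s : State) : Runs (.load r a) s (s.setReg r (s.mem (s.reg a))) 1
  | store (a b : ℕ) (s : State) : Runs (.store a b) s (s.setMem (s.reg a) (s.reg b)) 1
  | seq {P Q : Program} {s s' s'' : State} {t t' : ℕ} :
      Runs P s s' t → Runs Q s' s'' t' → Runs (.seq P Q) s s'' (t + t')
  | cond_then {r : ℕ} {P Q : Program} {s s' : State} {t : ℕ} :
      s.reg r ≠ 0 → Runs P s s' t → Runs (.cond r P Q) s s' (t + 1)
  | cond_else {r : ℕ} {P Q : Program} {s s' : State} {t : ℕ} :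
      s.reg r = 0 → Runs Q s s' t → Runs (.cond r P Q) s s' (t + 1)
  | loop_exit {r : ℕ} {P : Program} {s : State} :
      s.reg r = 0 → Runs (.loop r P) s s 1
  | loop_step {r : ℕ} {P : Program} {s s' s'' : State} {t t' : ℕ} :
      s.reg r ≠ 0 → Runs P s s' t → Runs (.loop r P) s' s'' t' →
      Runs (.loop r P) s s'' (t + t' + 1)

/-- The start state on the input word `w`: the word is in the memory cells
`0, …, w.length - 1` (one symbol per cell, as `0` or `1`), its length is in register `0`, and
everything else is `0`. -/
def State.start (w : List Bool) : State where
  reg := fun r => if r = 0 then w.length else 0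
  mem := fun i => if w[i]? = some true then 1 else 0

/-- `P` decides the problem `L` (a property of the instances in `α`, which are given to the
machine as words through `enc`) within the running time `T`: on every instance it halts after at
most `T x` steps, with `1` in register `0` on yes-instances and `0` on no-instances. -/
def Program.DecidesInTime {α : Type} (P : Program) (enc : α → List Bool) (L : α → Prop)
    (T : α → ℕ) : Prop :=
  ∀ x : α, ∃ (s : State) (t : ℕ), Runs P (State.start (enc x)) s t ∧ t ≤ T x ∧
    (L x → s.reg 0 = 1) ∧ (¬ L x → s.reg 0 = 0)

end RAM

/-- The problem `L`, with instances encoded by `enc`, is fixed-parameter tractable with respect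
to the parameter `κ`: some program decides it in time `f (κ x) * |x| ^ O(1)`, with `f` a
computable function. (The value of the parameter is not part of the input.) -/
def FixedParameterTractable {α : Type} (enc : α → List Bool) (L : α → Prop) (κ : α → ℕ) : Prop :=
  ∃ (f : ℕ → ℕ) (p : Polynomial ℕ) (P : RAM.Program), Computable f ∧
    P.DecidesInTime enc L (fun x => f (κ x) * p.eval (enc x).length)

/-! ### Conflict-Free Cut -/

namespace ConflictFreeCut

/-- An instance: a finite connected graph `G` and a conflict graph whose vertices are the edges
of `G`. -/
structure Instance : Type where
  /-- the number of vertices of the input graph -/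
  n : ℕ
  /-- the input graph -/
  G : SimpleGraph (Fin n)
  connected : G.Connected
  /-- the conflict graph -/
  conflict : SimpleGraph G.edgeSet

/-- The set `F` of edges is a conflict-free cut: `G - F` is disconnected, and `F` is independent
in the conflict graph. -/
def Instance.IsConflictFreeCut (I : Instance) (F : Set I.G.edgeSet) : Prop :=
  ¬ (I.G.deleteEdges (Subtype.val '' F)).Connected ∧ I.conflict.IsIndepSet F

/-- The question of the decision problem. -/
def Instance.HasConflictFreeCut (I : Instance) : Prop :=
  ∃ F : Set I.G.edgeSet, I.IsConflictFreeCut F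

/-- The vertex cover number of the input graph. -/
noncomputable def Instance.vertexCoverNumber (I : Instance) : ℕ :=
  I.G.vertexCoverNum.toNat

/-- `uv` and `xy` are edges of the input graph, and they are in conflict. -/
def Instance.Conflicting (I : Instance) (u v x y : Fin I.n) : Prop :=
  ∃ (h : I.G.Adj u v) (h' : I.G.Adj x y),
    I.conflict.Adj ⟨s(u, v), h⟩ ⟨s(x, y), h'⟩

open Classical in
/-- The word that encodes an instance: the number `n` of vertices in unary, closed by `false`;
the adjacency matrix of the input graph row by row (`n ^ 2` bits); and the adjacency matrix of the
conflict graph, with rows and columns indexed by the ordered pairs of vertices, row by row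
(`n ^ 4` bits). -/
noncomputable def Instance.encode (I : Instance) : List Bool :=
  List.replicate I.n true ++ [false]
    ++ List.ofFn (fun i : Fin (I.n * I.n) => decide (I.G.Adj i.divNat i.modNat))
    ++ List.ofFn (fun i : Fin ((I.n * I.n) * (I.n * I.n)) =>
        decide (I.Conflicting i.divNat.divNat i.divNat.modNat i.modNat.divNat i.modNat.modNat))

end ConflictFreeCut

/-!
A conflict-free cut of a connected graph is a nonconstant 2-colouring of the vertices such that no
two edges with differently coloured ends are in conflict. Fix the restriction of the colouring to a
vertex cover `X`. Every edge has an end in `X`, so whether its ends get different colours depends on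
a single literal, and the condition on two conflicting edges becomes an implication between two
literals. If moreover two vertices `w` and `w'` are required to have different colours, the question
is an instance of 2-satisfiability, which is decided by a transitive closure: it is satisfiable
unless some literal and its negation imply each other. There are `2 ^ |X|` colourings of `X` and
polynomially many pairs `w`, `w'`.

A vertex cover of the minimum size `k` is found by guessing, for one uncovered edge after the other,
which end to add. The guesses are the `k` binary digits of a code; the number of digits is increased
until some code leads to a cover with no more vertices than digits, so that fewer than `2 ^ (k + 1)`
codes are tried.

Every single attempt takes polynomial time because it is written in a language in which all loops
are bounded by multiples of `n`; a program of this language is compiled to the machine, and its cost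
is a polynomial in `n` that is read off from its syntax.
-/

open Finset Polynomial

namespace RAM

section Ensures

/-- Total correctness with a time bound: started in `s`, the program halts within `T` steps in a
state with the property `Q`. -/
def Program.Ensures (P : Program) (s : State) (T : ℕ) (Q : State → Prop) : Prop :=
  ∃ s' t, Runs P s s' t ∧ t ≤ T ∧ Q s'

namespace Program.Ensures

variable {P P' : Program} {s : State} {T T' r : ℕ} {Q Q' : State → Prop}

theorem of_runs {s' : State} (h : Runs P s s' T) (hQ : Q s') : P.Ensures s T Q :=
  ⟨s', T, h, le_rfl, hQ⟩

theorem mono (h : P.Ensures s T Q) (hT : T ≤ T') (hQ : ∀ s', Q s' → Q' s') :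
    P.Ensures s T' Q' :=
  let ⟨s', t, hrun, ht, hs'⟩ := h
  ⟨s', t, hrun, ht.trans hT, hQ s' hs'⟩

theorem seq (h : P.Ensures s T Q) (h' : ∀ s', Q s' → P'.Ensures s' T' Q') :
    (Program.seq P P').Ensures s (T + T') Q' :=
  let ⟨s', t, hrun, ht, hs'⟩ := h
  let ⟨s'', t', hrun', ht', hs''⟩ := h' s' hs'
  ⟨s'', t + t', .seq hrun hrun', Nat.add_le_add ht ht', hs''⟩

theorem cond (h : s.reg r ≠ 0 → P.Ensures s T Q) (h' : s.reg r = 0 → P'.Ensures s T' Q) :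
    (Program.cond r P P').Ensures s (T + T' + 1) Q := by
  by_cases hr : s.reg r = 0
  · obtain ⟨s', t, hrun, ht, hs'⟩ := h' hr
    exact ⟨s', t + 1, .cond_else hr hrun, by lia, hs'⟩
  · obtain ⟨s', t, hrun, ht, hs'⟩ := h hr
    exact ⟨s', t + 1, .cond_then hr hrun, by lia, hs'⟩

theorem loop {N : ℕ} {I : ℕ → State → Prop} (h : I N s)
    (hstep : ∀ N s', I N s' → s'.reg r ≠ 0 → P.Ensures s' T fun s'' => ∃ N' < N, I N' s'') :
    (Program.loop r P).Ensures s (N * (T + 1) + 1) fun s' => s'.reg r = 0 ∧ ∃ N, I N s' := by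
  induction N using Nat.strong_induction_on generalizing s with
  | _ N ih =>
    by_cases hr : s.reg r = 0
    · exact (of_runs (Runs.loop_exit hr) ⟨hr, N, h⟩).mono (by lia) fun _ => id
    · obtain ⟨s', t, hrun, ht, N', hN', h'⟩ := hstep N s h hr
      obtain ⟨s'', t', hrun', ht', hs''⟩ := ih N' hN' h'
      have hle : (N' + 1) * (T + 1) ≤ N * (T + 1) := Nat.mul_le_mul_right _ hN'
      exact ⟨s'', t + t' + 1, .loop_step hr hrun hrun', by linarith, hs''⟩

end Program.Ensures

theorem State.setReg_setReg (s : State) (r a b : ℕ) :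
    (s.setReg r a).setReg r b = s.setReg r b := by
  simp [State.setReg]

@[simp]
theorem State.reg_setReg_self (s : State) (r a : ℕ) : (s.setReg r a).reg r = a :=
  Function.update_self ..

@[simp]
theorem State.reg_setReg_of_ne (s : State) {r r' : ℕ} (a : ℕ) (h : r' ≠ r) :
    (s.setReg r a).reg r' = s.reg r' :=
  Function.update_of_ne h ..

/-- Assign the value of register `a` to the different register `r`. -/
def Program.move (r a : ℕ) : Program := .seq (.const r 0) (.add r r a)

theorem Program.move_ensures {r a : ℕ} (h : a ≠ r) {s : State} {Q : State → Prop}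
    (hQ : Q (s.setReg r (s.reg a))) : (move r a).Ensures s 2 Q := by
  refine .of_runs (.seq (.const r 0 s) (.add r r a _)) ?_
  simpa [State.setReg_setReg, h] using hQ

/-- Assign to register `r` the `m`-fold value of the different register `a`. -/
def Program.multiple (m r a : ℕ) : Program :=
  match m with
  | 0 => .const r 0
  | m + 1 => .seq (multiple m r a) (.add r r a)

theorem Program.multiple_ensures {m r a : ℕ} (h : a ≠ r) {s : State} {Q : State → Prop}
    (hQ : Q (s.setReg r (m * s.reg a))) : (multiple m r a).Ensures s (m + 1) Q := by
  induction m generalizing Q with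
  | zero => exact .of_runs (.const r 0 s) (by simpa using hQ)
  | succ m ih =>
    refine Ensures.seq (ih (Q := fun s' => s' = s.setReg r (m * s.reg a)) rfl) ?_
    rintro s' rfl
    refine .of_runs (.add r r a _) ?_
    simpa [State.setReg_setReg, h, Nat.succ_mul] using hQ

end Ensures

/-! ### A language with bounded loops -/

/-- The values of the variables of a program, and the memory. -/
structure Store (V : Type) where
  var : V → ℕ
  mem : ℕ → ℕ

namespace Store

variable {V : Type}

/-- Write the value `b` into memory cell `a`. -/
def setMem (σ : Store V) (a b : ℕ) : Store V :=
  { σ with mem := Function.update σ.mem a b }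

/-- Write the value `a` into the variable `x`. -/
def setVar [DecidableEq V] (σ : Store V) (x : V) (a : ℕ) : Store V :=
  { σ with var := Function.update σ.var x a }

section SetMem

variable (σ : Store V) (a b : ℕ)

@[simp]
theorem var_setMem : (σ.setMem a b).var = σ.var := rfl

@[simp]
theorem mem_setMem (a' : ℕ) : (σ.setMem a b).mem a' = if a' = a then b else σ.mem a' :=
  Function.update_apply ..

end SetMem

section SetVar

variable [DecidableEq V] (σ : Store V) (x y : V) (a b : ℕ)

@[simp]
theorem var_setVar : (σ.setVar x a).var y = if y = x then a else σ.var y :=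
  Function.update_apply ..

@[simp]
theorem mem_setVar : (σ.setVar x a).mem = σ.mem := rfl

@[simp]
theorem setVar_setVar : (σ.setVar x a).setVar x b = σ.setVar x b := by
  simp [setVar]

@[simp]
theorem setVar_self : σ.setVar x (σ.var x) = σ := by
  simp [setVar]

end SetVar

end Store

/-- Expressions over the variables `V`. They are evaluated relative to a size parameter `n`. -/
inductive Expr (V : Type) : Type
  | var (x : V)
  | lit (a : ℕ)
  | add (e e' : Expr V)
  | sub (e e' : Expr V)
  | load (e : Expr V)
  | ite (e e' e'' : Expr V)
  /-- the sum of `e` over all values `x < m * n` -/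
  | sum (m : ℕ) (x : V) (e : Expr V)

/-- Commands over the variables `V`. They are evaluated relative to a size parameter `n`. -/
inductive Cmd (V : Type) : Type
  | skip
  | assign (x : V) (e : Expr V)
  | store (e e' : Expr V)
  | seq (c c' : Cmd V)
  | ite (e : Expr V) (c c' : Cmd V)
  /-- execute `c` for all values `x < m * n`, in decreasing order, and restore `x` -/
  | loop (m : ℕ) (x : V) (c : Cmd V)

instance {V : Type} : Coe V (Expr V) := ⟨.var⟩

instance {V : Type} (a : ℕ) : OfNat (Expr V) a := ⟨.lit a⟩

instance {V : Type} : Add (Expr V) := ⟨.add⟩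

instance {V : Type} : Sub (Expr V) := ⟨.sub⟩

section Semantics

variable {V : Type} [DecidableEq V]

/-- The value of an expression. -/
def Expr.eval (n : ℕ) : Expr V → Store V → ℕ
  | var x, σ => σ.var x
  | lit a, _ => a
  | add e e', σ => e.eval n σ + e'.eval n σ
  | sub e e', σ => e.eval n σ - e'.eval n σ
  | load e, σ => σ.mem (e.eval n σ)
  | ite e e' e'', σ => if e.eval n σ ≠ 0 then e'.eval n σ else e''.eval n σ
  | sum m x e, σ => ∑ i ∈ range (m * n), e.eval n (σ.setVar x i)

/-- The effect of a command. -/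
def Cmd.eval (n : ℕ) : Cmd V → Store V → Store V
  | skip, σ => σ
  | assign x e, σ => σ.setVar x (e.eval n σ)
  | store e e', σ => σ.setMem (e.eval n σ) (e'.eval n σ)
  | seq c c', σ => c'.eval n (c.eval n σ)
  | ite e c c', σ => if e.eval n σ ≠ 0 then c.eval n σ else c'.eval n σ
  | loop m x c, σ =>
    ((List.range (m * n)).foldr (fun i τ => c.eval n (τ.setVar x i)) σ).setVar x (σ.var x)

end Semantics

section Compile

variable {V : Type} [Encodable V]

/-- The register of a variable. Register `0` is left to the input and the answer, and register `1`
holds the size parameter. -/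
def varReg (x : V) : ℕ := 2 * Encodable.encode x + 2

/-- The register of the `d`-th intermediate value. -/
def scratch (d : ℕ) : ℕ := 2 * d + 3

/-- Decrease the index of a loop over the variable `x`; the index is kept in `scratch (d + 1)`. -/
def nextIndex (x : V) (d : ℕ) : Program :=
  .seq (.const (scratch (d + 2)) 1)
    (.seq (.sub (scratch (d + 1)) (scratch (d + 1)) (scratch (d + 2)))
      (.move (varReg x) (scratch (d + 1))))

/-- The loop that runs `body` for all values `x < m * n`, in decreasing order. The initial value
of `x` is kept in `scratch d`. -/
def forLoop (m : ℕ) (x : V) (d : ℕ) (body : Program) : Program :=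
  .seq (.move (scratch d) (varReg x))
    (.seq (.multiple m (scratch (d + 1)) 1)
      (.seq (.loop (scratch (d + 1)) (.seq (nextIndex x d) body))
        (.move (varReg x) (scratch d))))

/-- The time needed by `forLoop`, if `body` needs time `p`. -/
noncomputable def forLoopCost (m : ℕ) (p : ℕ[X]) : ℕ[X] := (m : ℕ[X]) * X * (p + 5) + (m : ℕ[X]) + 6

/-- A program that computes the value of an expression into `scratch d`. -/
def Expr.compile : Expr V → ℕ → Program
  | var x, d => .move (scratch d) (varReg x)
  | lit a, d => .const (scratch d) a
  | add e e', d => .seq (e.compile d)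
      (.seq (e'.compile (d + 1)) (.add (scratch d) (scratch d) (scratch (d + 1))))
  | sub e e', d => .seq (e.compile d)
      (.seq (e'.compile (d + 1)) (.sub (scratch d) (scratch d) (scratch (d + 1))))
  | load e, d => .seq (e.compile d) (.load (scratch d) (scratch d))
  | ite e e' e'', d => .seq (e.compile d) (.cond (scratch d) (e'.compile d) (e''.compile d))
  | sum m x e, d => .seq (.const (scratch d) 0) (forLoop m x (d + 1)
      (.seq (e.compile (d + 3)) (.add (scratch d) (scratch d) (scratch (d + 3)))))

/-- The time needed to evaluate an expression, as a polynomial in the size parameter. -/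
noncomputable def Expr.cost : Expr V → ℕ[X]
  | var _ => 2
  | lit _ => 1
  | add e e' => e.cost + (e'.cost + 1)
  | sub e e' => e.cost + (e'.cost + 1)
  | load e => e.cost + 1
  | ite e e' e'' => e.cost + (e'.cost + e''.cost + 1)
  | sum m _ e => 1 + forLoopCost m (e.cost + 1)

/-- A program that has the effect of a command; it overwrites the intermediate values from
`scratch d` on. -/
def Cmd.compile : Cmd V → ℕ → Program
  | skip, _ => .skip
  | assign x e, d => .seq (e.compile d) (.move (varReg x) (scratch d))
  | store e e', d => .seq (e.compile d)
      (.seq (e'.compile (d + 1)) (.store (scratch d) (scratch (d + 1))))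
  | seq c c', d => .seq (c.compile d) (c'.compile d)
  | ite e c c', d => .seq (e.compile d) (.cond (scratch d) (c.compile d) (c'.compile d))
  | loop m x c, d => forLoop m x d (c.compile (d + 2))

/-- The time needed to execute a command, as a polynomial in the size parameter. -/
noncomputable def Cmd.cost : Cmd V → ℕ[X]
  | skip => 1
  | assign _ e => e.cost + 2
  | store e e' => e.cost + (e'.cost + 1)
  | seq c c' => c.cost + c'.cost
  | ite e c c' => e.cost + (c.cost + c'.cost + 1)
  | loop m _ c => forLoopCost m c.cost

/-- The state `s` of the machine represents the store `σ` and the size parameter `n`. -/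
structure Represents (n : ℕ) (s : State) (σ : Store V) : Prop where
  size : s.reg 1 = n
  var (x : V) : s.reg (varReg x) = σ.var x
  mem : s.mem = σ.mem

/-- The intermediate values below `scratch d` are the same in `s` and `s'`. -/
def KeepsBelow (d : ℕ) (s s' : State) : Prop := ∀ d' < d, s'.reg (scratch d') = s.reg (scratch d')

theorem varReg_ne_scratch (x : V) (d : ℕ) : varReg x ≠ scratch d := by
  unfold varReg scratch; lia

theorem scratch_ne_varReg (x : V) (d : ℕ) : scratch d ≠ varReg x := (varReg_ne_scratch x d).symm

theorem one_ne_varReg (x : V) : 1 ≠ varReg x := by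
  unfold varReg; lia

theorem one_ne_scratch (d : ℕ) : 1 ≠ scratch d := by
  unfold scratch; lia

theorem scratch_ne {d d' : ℕ} (h : d ≠ d') : scratch d ≠ scratch d' := by
  unfold scratch; lia

theorem varReg_injective : Function.Injective (varReg (V := V)) := fun x y h =>
  Encodable.encode_injective (by unfold varReg at h; lia)

namespace KeepsBelow

variable {d d' : ℕ} {s s' s'' : State}

theorem refl : KeepsBelow d s s := fun _ _ => rfl

theorem trans (h : KeepsBelow d s s') (h' : KeepsBelow d' s' s'') (hd : d ≤ d') :
    KeepsBelow d s s'' :=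
  fun i hi => (h' i (hi.trans_le hd)).trans (h i hi)

theorem setScratch (h : KeepsBelow d s s') (hd : d ≤ d') (a : ℕ) :
    KeepsBelow d s (s'.setReg (scratch d') a) :=
  fun i hi => (State.reg_setReg_of_ne _ _ (scratch_ne (by lia))).trans (h i hi)

theorem setVar (h : KeepsBelow d s s') (x : V) (a : ℕ) :
    KeepsBelow d s (s'.setReg (varReg x) a) :=
  fun i hi => (State.reg_setReg_of_ne _ _ (scratch_ne_varReg x i)).trans (h i hi)

end KeepsBelow

namespace Represents

variable {n : ℕ} {s : State} {σ : Store V}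

theorem setScratch (h : Represents n s σ) (d a : ℕ) :
    Represents n (s.setReg (scratch d) a) σ where
  size := (State.reg_setReg_of_ne _ _ (one_ne_scratch d)).trans h.size
  var x := (State.reg_setReg_of_ne _ _ (varReg_ne_scratch x d)).trans (h.var x)
  mem := h.mem

theorem setMem (h : Represents n s σ) (a b : ℕ) :
    Represents n (s.setMem a b) (σ.setMem a b) where
  size := h.size
  var := h.var
  mem := by simp [State.setMem, Store.setMem, h.mem]

theorem setVar [DecidableEq V] (h : Represents n s σ) (x : V) (a : ℕ) :
    Represents n (s.setReg (varReg x) a) (σ.setVar x a) where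
  size := (State.reg_setReg_of_ne _ _ (one_ne_varReg x)).trans h.size
  var y := by
    by_cases hy : y = x
    · simp [hy]
    · simp [hy, varReg_injective.ne hy, h.var y]
  mem := h.mem

theorem setSize (h : Represents n s σ) (a : ℕ) : Represents a (s.setReg 1 a) σ where
  size := State.reg_setReg_self ..
  var x := (State.reg_setReg_of_ne _ _ (one_ne_varReg x).symm).trans (h.var x)
  mem := h.mem

end Represents

/-- The state in which `forLoop` executes its body for `x = i`. -/
def atIndex (x : V) (d i : ℕ) (s : State) : State :=
  ((s.setReg (scratch (d + 2)) 1).setReg (scratch (d + 1)) i).setReg (varReg x) i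

section ForLoop

variable {n m d i : ℕ} {x : V} {s : State} {σ : Store V}

theorem nextIndex_ensures {Q : State → Prop} (hi : s.reg (scratch (d + 1)) = i + 1)
    (hQ : Q (atIndex x d i s)) : (nextIndex x d).Ensures s 4 Q := by
  have hne : scratch (d + 1) ≠ scratch (d + 2) := scratch_ne (by lia)
  refine .seq (T := 1) (T' := 3) (.of_runs (.const _ _ _) rfl) (Q := (_ = ·)) ?_
  rintro _ rfl
  refine .seq (T := 1) (T' := 2) (.of_runs (.sub _ _ _ _) rfl) (Q := (_ = ·)) ?_
  rintro _ rfl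
  refine Program.move_ensures (scratch_ne_varReg x (d + 1)) ?_
  simpa [atIndex, hne, hi] using hQ

theorem reg_atIndex (d i : ℕ) (x : V) (s : State) :
    (atIndex x d i s).reg (scratch (d + 1)) = i := by
  simp [atIndex, scratch_ne_varReg]

theorem KeepsBelow.atIndex {s' : State} (h : KeepsBelow d s s') {d' : ℕ} (hd : d ≤ d' + 1) :
    KeepsBelow d s (atIndex x d' i s') :=
  ((h.setScratch (by lia) _).setScratch hd _).setVar _ _

theorem Represents.atIndex [DecidableEq V] (h : Represents n s σ) (d i : ℕ) (x : V) :
    Represents n (atIndex x d i s) (σ.setVar x i) :=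
  ((h.setScratch _ _).setScratch _ _).setVar x i

theorem forLoop_ensures {body : Program} {p : ℕ[X]}
    {Q : State → Prop} (I : ℕ → State → Prop) (h : Represents n s σ)
    (hstart : I (m * n)
      ((s.setReg (scratch d) (σ.var x)).setReg (scratch (d + 1)) (m * n)))
    (hstep : ∀ i < m * n, ∀ s', I (i + 1) s' → body.Ensures (atIndex x d i s') (p.eval n)
      fun s'' => I i s'' ∧ s''.reg (scratch (d + 1)) = i)
    (hfinal : ∀ s', I 0 s' → s'.reg (scratch d) = σ.var x ∧ Q (s'.setReg (varReg x) (σ.var x))) :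
    (forLoop m x d body).Ensures s ((forLoopCost m p).eval n) Q := by
  suffices hrun : (forLoop m x d body).Ensures s
      (2 + ((m + 1) + ((m * n * (4 + p.eval n + 1) + 1) + 2))) Q from
    hrun.mono (by simp [forLoopCost]; lia) fun _ => id
  refine .seq (Program.move_ensures (varReg_ne_scratch x d) (Q := (· = _)) rfl) ?_
  rintro _ rfl
  refine .seq (Program.multiple_ensures (one_ne_scratch _) (Q := (· = _)) rfl) ?_
  rintro _ rfl
  rw [h.var, State.reg_setReg_of_ne _ _ (one_ne_scratch d), h.size]
  refine .seq (Program.Ensures.loop (N := m * n)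
    (I := fun i s' => i ≤ m * n ∧ I i s' ∧ s'.reg (scratch (d + 1)) = i) ?_ ?_) ?_
  · exact ⟨le_rfl, hstart, State.reg_setReg_self ..⟩
  · rintro i s' ⟨hi, hI, hreg⟩ hpos
    obtain ⟨i, rfl⟩ := Nat.exists_eq_succ_of_ne_zero (hreg ▸ hpos)
    refine .seq (nextIndex_ensures hreg rfl) ?_
    rintro _ rfl
    exact (hstep i hi s' hI).mono le_rfl fun _ h' => ⟨i, i.lt_succ_self, by lia, h'⟩
  · rintro s' ⟨hzero, i, -, hI, hreg⟩
    obtain rfl : i = 0 := hreg.symm.trans hzero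
    obtain ⟨hreg, hQ⟩ := hfinal s' hI
    exact Program.move_ensures (scratch_ne_varReg x d) (by rwa [hreg])

end ForLoop

section Correctness

variable {n d : ℕ} {s : State} {σ : Store V}

/-- The postcondition of the program `e.compile d` started in the state `s`, where `a` is the
value of `e`. -/
structure HasValue (n d : ℕ) (σ : Store V) (a : ℕ) (s s' : State) : Prop where
  represents : Represents n s' σ
  keepsBelow : KeepsBelow d s s'
  value : s'.reg (scratch d) = a

theorem HasValue.of_setReg (h : Represents n s σ) (a : ℕ) :
    HasValue n d σ a s (s.setReg (scratch d) a) :=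
  ⟨h.setScratch d a, KeepsBelow.refl.setScratch le_rfl a, State.reg_setReg_self ..⟩

theorem HasValue.setReg {s' : State} {a : ℕ} (h : HasValue n d σ a s s') (b : ℕ) :
    HasValue n d σ b s (s'.setReg (scratch d) b) :=
  ⟨h.represents.setScratch d b, h.keepsBelow.setScratch le_rfl b, State.reg_setReg_self ..⟩

theorem HasValue.trans {d' : ℕ} {s' s'' : State} {a b : ℕ} (h : HasValue n d σ a s s')
    (h' : HasValue n d' σ b s' s'') (hd : d < d') :
    HasValue n d σ a s s'' :=
  ⟨h'.represents, h.keepsBelow.trans h'.keepsBelow hd.le, (h'.keepsBelow d hd).trans h.value⟩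

theorem HasValue.trans_same {s' s'' : State} {a b : ℕ} (h : HasValue n d σ a s s')
    (h' : HasValue n d σ b s' s'') : HasValue n d σ b s s'' :=
  ⟨h'.represents, h.keepsBelow.trans h'.keepsBelow le_rfl, h'.value⟩

/-- The program computes the value `a` into `scratch d`, in time `T`. -/
def ComputesValue (n d : ℕ) (σ : Store V) (a : ℕ) (P : Program) (T : ℕ) : Prop :=
  ∀ s, Represents n s σ → P.Ensures s T (HasValue n d σ a s)

theorem ComputesValue.pair {a b T T' : ℕ} {P P' P'' : Program} {s : State} {Q : State → Prop}
    (hP : ComputesValue n d σ a P T) (hP' : ComputesValue n (d + 1) σ b P' T')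
    (h : Represents n s σ)
    (hQ : ∀ s', HasValue n d σ a s s' → s'.reg (scratch (d + 1)) = b → P''.Ensures s' 1 Q) :
    (Program.seq P (.seq P' P'')).Ensures s (T + (T' + 1)) Q :=
  .seq (hP s h) fun s' h' => .seq (hP' s' h'.represents) fun s'' h'' =>
    hQ s'' (h'.trans h'' d.lt_succ_self) h''.value

variable [DecidableEq V]

theorem ComputesValue.sum {m : ℕ} {x : V} {a : ℕ → ℕ} {P : Program} {p : ℕ[X]}
    (hP : ∀ i, ComputesValue n (d + 3) (σ.setVar x i) (a i) P (p.eval n)) :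
    ComputesValue n d σ (∑ i ∈ range (m * n), a i)
      (.seq (.const (scratch d) 0) (forLoop m x (d + 1)
        (.seq P (.add (scratch d) (scratch d) (scratch (d + 3))))))
      ((1 + forLoopCost m (p + 1)).eval n) := by
  intro s h
  rw [eval_add, eval_one]
  refine .seq (.of_runs (.const _ 0 s) rfl) (Q := (_ = ·)) ?_
  rintro _ rfl
  refine forLoop_ensures
    (I := fun i s' => (∃ b, Represents n s' (σ.setVar x b)) ∧ KeepsBelow d s s' ∧
      s'.reg (scratch (d + 1)) = σ.var x ∧
      s'.reg (scratch d) + ∑ j ∈ range i, a j = ∑ j ∈ range (m * n), a j)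
    (h.setScratch d 0) ?_ ?_ ?_
  · refine ⟨⟨σ.var x, ?_⟩, ?_, ?_, ?_⟩
    · simpa using ((h.setScratch _ _).setScratch _ _).setScratch _ _
    · exact ((KeepsBelow.refl.setScratch le_rfl _).setScratch (by lia) _).setScratch (by lia) _
    · simp [scratch]
    · simp [scratch_ne (show d ≠ d + 1 by lia), scratch_ne (show d ≠ d + 1 + 1 by lia)]
  · rintro i - s' ⟨⟨b, hb⟩, hkeep, hsave, hsum⟩
    have hi : Represents n (atIndex x (d + 1) i s') (σ.setVar x i) := by
      simpa using hb.atIndex (d + 1) i x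
    rw [eval_add, eval_one]
    refine .seq (hP i _ hi) fun s'' h'' => .of_runs (.add ..) ?_
    have heq : ∀ d' < d + 2, s''.reg (scratch d') = s'.reg (scratch d') := fun d' hd' =>
      (h''.keepsBelow d' (by lia)).trans
        (KeepsBelow.refl.atIndex (d := d + 2) le_rfl d' hd')
    refine ⟨⟨⟨i, h''.represents.setScratch _ _⟩, ?_, ?_, ?_⟩, ?_⟩
    · exact fun d' hd' => by
        simpa [scratch_ne hd'.ne, heq d' (by lia)] using hkeep d' hd'
    · simpa [scratch_ne d.succ_ne_self, heq (d + 1) (by lia)] using hsave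
    · rw [sum_range_succ] at hsum
      simp only [State.reg_setReg_self, heq d (by lia), h''.value]
      lia
    · rw [State.reg_setReg_of_ne _ _ (scratch_ne (by lia)), h''.keepsBelow _ (by lia)]
      exact reg_atIndex ..
  · rintro s' ⟨⟨b, hb⟩, hkeep, hsave, hsum⟩
    refine ⟨hsave, by simpa using hb.setVar x (σ.var x), hkeep.setVar _ _, ?_⟩
    simpa [scratch_ne_varReg] using hsum

theorem Expr.compile_computesValue (n : ℕ) (e : Expr V) (d : ℕ) (σ : Store V) :
    ComputesValue n d σ (e.eval n σ) (e.compile d) (e.cost.eval n) := by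
  induction e generalizing d σ with
  | var x =>
    intro s h
    rw [cost, eval_ofNat]
    exact Program.move_ensures (varReg_ne_scratch x d) (h.var x ▸ HasValue.of_setReg h _)
  | lit a =>
    intro s h
    rw [cost, eval_one]
    exact .of_runs (.const _ a s) (HasValue.of_setReg h a)
  | add e e' ih ih' =>
    intro s h
    simp only [cost, eval_add, eval_one]
    refine (ih d σ).pair (ih' (d + 1) σ) h fun s' h' hb => .of_runs (.add ..) ?_
    rw [h'.value, hb]
    exact h'.setReg _
  | sub e e' ih ih' =>
    intro s h
    simp only [cost, eval_add, eval_one]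
    refine (ih d σ).pair (ih' (d + 1) σ) h fun s' h' hb => .of_runs (.sub ..) ?_
    rw [h'.value, hb]
    exact h'.setReg _
  | load e ih =>
    intro s h
    rw [cost, eval_add, eval_one]
    refine .seq (ih d σ s h) fun s' h' => .of_runs (.load ..) ?_
    rw [h'.value, h'.represents.mem]
    exact h'.setReg _
  | ite e e' e'' ih ih' ih'' =>
    intro s h
    simp only [cost, eval_add, eval_one]
    refine .seq (ih d σ s h) fun s' h' => .cond (fun hr => ?_) fun hr => ?_
    · rw [h'.value] at hr
      rw [eval, if_pos hr]
      exact (ih' d σ s' h'.represents).mono le_rfl fun _ => h'.trans_same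
    · rw [h'.value] at hr
      rw [eval, if_neg (not_not.2 hr)]
      exact (ih'' d σ s' h'.represents).mono le_rfl fun _ => h'.trans_same
  | sum m x e ih => exact ComputesValue.sum fun i => ih (d + 3) (σ.setVar x i)

/-- The program leads to the store `σ'`, in time `T`. -/
def LeadsTo (n d : ℕ) (σ σ' : Store V) (P : Program) (T : ℕ) : Prop :=
  ∀ s, Represents n s σ → P.Ensures s T fun s' => Represents n s' σ' ∧ KeepsBelow d s s'

theorem LeadsTo.loop {m : ℕ} {x : V} {f : Store V → Store V} {P : Program} {p : ℕ[X]}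
    (hP : ∀ σ, LeadsTo n (d + 2) σ (f σ) P (p.eval n)) :
    LeadsTo n d σ
      (((List.range (m * n)).foldr (fun i τ => f (τ.setVar x i)) σ).setVar x (σ.var x))
      (forLoop m x d P) ((forLoopCost m p).eval n) := by
  intro s h
  set step : ℕ → Store V → Store V := fun i τ => f (τ.setVar x i)
  refine forLoop_ensures
    (I := fun i s' => (∃ τ, Represents n s' τ ∧
        (List.range i).foldr step τ = (List.range (m * n)).foldr step σ) ∧
      KeepsBelow d s s' ∧ s'.reg (scratch d) = σ.var x)
    h ?_ ?_ ?_
  · refine ⟨⟨σ, (h.setScratch _ _).setScratch _ _, rfl⟩, ?_, by simp [scratch]⟩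
    exact (KeepsBelow.refl.setScratch le_rfl _).setScratch (by lia) _
  · rintro i - s' ⟨⟨τ, hτ, hfold⟩, hkeep, hsave⟩
    refine (hP _ _ (hτ.atIndex d i x)).mono le_rfl fun s'' ⟨h'', hkeep'⟩ => ?_
    have heq : ∀ d' < d + 1, s''.reg (scratch d') = s'.reg (scratch d') := fun d' hd' =>
      (hkeep' d' (by lia)).trans
        (KeepsBelow.refl.atIndex (d := d + 1) le_rfl d' hd')
    refine ⟨⟨⟨_, h'', ?_⟩, fun d' hd' => ?_, ?_⟩, ?_⟩
    · rw [← hfold, List.range_succ, List.foldr_append]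
      rfl
    · exact (heq d' (by lia)).trans (hkeep d' hd')
    · exact (heq d d.lt_succ_self).trans hsave
    · exact (hkeep' _ (by lia)).trans (reg_atIndex ..)
  · rintro s' ⟨⟨τ, hτ, rfl⟩, hkeep, hsave⟩
    exact ⟨hsave, hτ.setVar x _, hkeep.setVar x _⟩

theorem Cmd.compile_leadsTo (n : ℕ) (c : Cmd V) (d : ℕ) (σ : Store V) :
    LeadsTo n d σ (c.eval n σ) (c.compile d) (c.cost.eval n) := by
  induction c generalizing d σ with
  | skip =>
    intro s h
    rw [cost, eval_one]
    exact .of_runs (.skip s) ⟨h, .refl⟩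
  | assign x e =>
    intro s h
    rw [cost, eval_add, eval_ofNat]
    refine .seq (e.compile_computesValue n d σ s h) fun s' h' => ?_
    refine Program.move_ensures (scratch_ne_varReg x d) ?_
    rw [h'.value]
    exact ⟨h'.represents.setVar x _, h'.keepsBelow.setVar x _⟩
  | store e e' =>
    intro s h
    simp only [cost, eval_add, eval_one]
    refine (e.compile_computesValue n d σ).pair (e'.compile_computesValue n (d + 1) σ) h
      fun s' h' hb => .of_runs (.store ..) ?_
    rw [h'.value, hb]
    exact ⟨h'.represents.setMem _ _, h'.keepsBelow⟩
  | seq c c' ih ih' =>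
    intro s h
    rw [cost, eval_add]
    refine .seq (ih d σ s h) fun s' ⟨h', hkeep⟩ => ?_
    exact (ih' d _ s' h').mono le_rfl fun _ ⟨h'', hkeep'⟩ => ⟨h'', hkeep.trans hkeep' le_rfl⟩
  | ite e c c' ih ih' =>
    intro s h
    simp only [cost, eval_add, eval_one]
    refine .seq (e.compile_computesValue n d σ s h) fun s' h' => .cond (fun hr => ?_) fun hr => ?_
    · rw [h'.value] at hr
      rw [eval, if_pos hr]
      exact (ih d σ s' h'.represents).mono le_rfl fun _ ⟨h'', hkeep⟩ =>
        ⟨h'', h'.keepsBelow.trans hkeep le_rfl⟩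
    · rw [h'.value] at hr
      rw [eval, if_neg (not_not.2 hr)]
      exact (ih' d σ s' h'.represents).mono le_rfl fun _ ⟨h'', hkeep⟩ =>
        ⟨h'', h'.keepsBelow.trans hkeep le_rfl⟩
  | loop m x c ih => exact LeadsTo.loop fun σ => ih (d + 2) σ

theorem Cmd.ensures (c : Cmd V) (h : Represents n s σ) :
    (c.compile 0).Ensures s (c.cost.eval n) fun s' => Represents n s' (c.eval n σ) :=
  (c.compile_leadsTo n 0 σ s h).mono le_rfl fun _ h' => h'.1

theorem Cmd.while_ensures (c : Cmd V) (x : V) {I : Store V → Prop} (f : Store V → ℕ) {N : ℕ}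
    (hstep : ∀ τ, I τ → τ.var x ≠ 0 → I (c.eval n τ) ∧ f (c.eval n τ) < f τ)
    (h : Represents n s σ) (hI : I σ) (hN : f σ ≤ N) :
    (Program.loop (varReg x) (c.compile 0)).Ensures s (N * (c.cost.eval n + 1) + 1)
      fun s' => ∃ τ, Represents n s' τ ∧ I τ ∧ τ.var x = 0 := by
  refine (Program.Ensures.loop (N := f σ)
    (I := fun N s' => ∃ τ, Represents n s' τ ∧ I τ ∧ f τ = N) ⟨σ, h, hI, rfl⟩ ?_).mono
    (Nat.add_le_add_right (Nat.mul_le_mul_right _ hN) 1) ?_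
  · rintro _ s' ⟨τ, h', hτ, rfl⟩ hpos
    obtain ⟨hI', hlt⟩ := hstep τ hτ (h'.var x ▸ hpos)
    exact (c.ensures h').mono le_rfl fun _ h'' => ⟨_, hlt, _, h'', hI', rfl⟩
  · rintro s' ⟨hzero, _, τ, h', hτ, -⟩
    exact ⟨τ, h', hτ, h'.var x ▸ hzero⟩

end Correctness

end Compile

/-! ### Truth values and loop rules -/

namespace Expr

variable {V : Type} [DecidableEq V]

/-- The truth value of an expression; every value except `0` counts as true. -/
def Holds (n : ℕ) (e : Expr V) (σ : Store V) : Prop := e.eval n σ ≠ 0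

/-- Conjunction. -/
def and (e e' : Expr V) : Expr V := .ite e e' (.lit 0)

/-- Disjunction. -/
def or (e e' : Expr V) : Expr V := .add e e'

/-- Negation. -/
def not (e : Expr V) : Expr V := .sub (.lit 1) e

/-- Equivalence. -/
def iff (e e' : Expr V) : Expr V := .ite e e' e'.not

/-- The strict order. -/
def lt (e e' : Expr V) : Expr V := .sub e' e

/-- Equality. -/
def eq (e e' : Expr V) : Expr V := (Expr.add (.sub e e') (.sub e' e)).not

variable {n : ℕ} {σ : Store V} {e e' : Expr V}

@[simp]
theorem eval_var (x : V) : (x : Expr V).eval n σ = σ.var x := rfl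

@[simp]
theorem eval_zero : (0 : Expr V).eval n σ = 0 := rfl

@[simp]
theorem eval_one : (1 : Expr V).eval n σ = 1 := rfl

@[simp]
theorem eval_ofNat (a : ℕ) : (OfNat.ofNat a : Expr V).eval n σ = a := rfl

@[simp]
theorem eval_add : (e + e').eval n σ = e.eval n σ + e'.eval n σ := rfl

@[simp]
theorem eval_sub : (e - e').eval n σ = e.eval n σ - e'.eval n σ := rfl

@[simp]
theorem eval_load : (load e).eval n σ = σ.mem (e.eval n σ) := rfl

@[simp]
theorem holds_and : (e.and e').Holds n σ ↔ e.Holds n σ ∧ e'.Holds n σ := by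
  simp [Holds, and, eval]

@[simp]
theorem holds_or : (e.or e').Holds n σ ↔ e.Holds n σ ∨ e'.Holds n σ := by
  simp only [Holds, or, eval]; lia

@[simp]
theorem holds_not : e.not.Holds n σ ↔ ¬ e.Holds n σ := by
  simp only [Holds, not, eval]; lia

@[simp]
theorem holds_iff : (e.iff e').Holds n σ ↔ (e.Holds n σ ↔ e'.Holds n σ) := by
  simp only [Holds, iff, eval, not]; split_ifs <;> grind

@[simp]
theorem holds_lt : (e.lt e').Holds n σ ↔ e.eval n σ < e'.eval n σ := by
  simp only [Holds, lt, eval]; lia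

@[simp]
theorem holds_eq : (e.eq e').Holds n σ ↔ e.eval n σ = e'.eval n σ := by
  simp only [Holds, eq, not, eval]; lia

@[simp]
theorem holds_load : (load e).Holds n σ ↔ σ.mem (e.eval n σ) ≠ 0 := Iff.rfl

@[simp]
theorem holds_sum_one {x : V} :
    (sum 1 x e).Holds n σ ↔ ∃ i : Fin n, e.Holds n (σ.setVar x i) := by
  simp [Holds, eval, Finset.sum_eq_zero_iff, Fin.exists_iff]

end Expr
end RAM

/-! ### Reasoning about loops -/

namespace RAM.Cmd

variable {V : Type} [DecidableEq V] {n : ℕ} {σ : Store V} {x : V}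

/-- The variables that a command may change. -/
def assigned : Cmd V → Finset V
  | skip => ∅
  | assign x _ => {x}
  | store _ _ => ∅
  | seq c c' => c.assigned ∪ c'.assigned
  | ite _ c c' => c.assigned ∪ c'.assigned
  | loop _ _ c => c.assigned

theorem eval_ite_of_holds {e : Expr V} {c c' : Cmd V} (h : e.Holds n σ) :
    (ite e c c').eval n σ = c.eval n σ :=
  if_pos h

theorem eval_ite_of_not_holds {e : Expr V} {c c' : Cmd V} (h : ¬ e.Holds n σ) :
    (ite e c c').eval n σ = c'.eval n σ :=
  if_neg h

theorem eval_loop_eq_foldr {ι : Type*} {m : ℕ} {c : Cmd V} {l : List ι} {idx : ι → ℕ}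
    (hl : l.map idx = List.range (m * n)) :
    (loop m x c).eval n σ =
      (l.foldr (fun i τ => c.eval n (τ.setVar x (idx i))) σ).setVar x (σ.var x) := by
  rw [eval, ← hl, List.foldr_map]

theorem var_eval_of_notMem {c : Cmd V} (h : x ∉ c.assigned) :
    (c.eval n σ).var x = σ.var x := by
  induction c generalizing σ with
  | skip | store => rfl
  | assign y e => simp_all [eval, assigned]
  | seq c c' ih ih' =>
    rw [assigned, notMem_union] at h
    exact (ih' h.2).trans (ih h.1)
  | ite e c c' ih ih' =>
    rw [assigned, notMem_union] at h
    rw [eval]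
    split_ifs
    exacts [ih h.1, ih' h.2]
  | loop m y c ih =>
    rw [eval, Store.var_setVar]
    split_ifs with hxy
    · rw [hxy]
    · refine List.foldrRecOn (motive := fun τ : Store V => τ.var x = σ.var x) _ _ rfl
        fun τ hτ i _ => ?_
      rw [ih h, Store.var_setVar, if_neg hxy, hτ]

/-- If every round of a loop transforms the value that is represented by the store under `R` as
`step` does, then the loop transforms it as the fold of `step` does. -/
theorem loop_induction {ι α : Type*} {m : ℕ} {c : Cmd V} {l : List ι} {idx : ι → ℕ}
    (hl : l.map idx = List.range (m * n)) {R : Store V → α → Prop} {step : ι → α → α}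
    (hR : ∀ τ a i, R τ a → R (τ.setVar x i) a)
    (hstep : ∀ i τ a, (∀ y ∉ c.assigned, y ≠ x → τ.var y = σ.var y) → τ.var x = idx i →
      R τ a → R (c.eval n τ) (step i a))
    {a : α} (h : R σ a) : R ((loop m x c).eval n σ) (l.foldr step a) := by
  rw [eval_loop_eq_foldr hl]
  refine hR _ _ _ ?_
  suffices h : R (l.foldr (fun i τ => c.eval n (τ.setVar x (idx i))) σ) (l.foldr step a) ∧
      ∀ y ∉ c.assigned, y ≠ x →
        (l.foldr (fun i τ => c.eval n (τ.setVar x (idx i))) σ).var y = σ.var y from h.1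
  clear hl
  induction l with
  | nil => exact ⟨h, fun _ _ _ => rfl⟩
  | cons i l ih =>
    refine ⟨hstep i _ _ (fun y hy hyx => ?_) (by simp) (hR _ _ _ ih.1), fun y hy hyx => ?_⟩
    · simpa [hyx] using ih.2 y hy hyx
    · rw [List.foldr_cons, var_eval_of_notMem hy]
      simpa [hyx] using ih.2 y hy hyx

theorem loop_loop_induction {ι α : Type*} {m : ℕ} {y : V} (hxy : x ≠ y) {c : Cmd V}
    (hx : x ∉ c.assigned) {l : List ι} {idx : ι → ℕ} (hl : l.map idx = List.range (m * n))
    {R : Store V → α → Prop} {step : ι × ι → α → α}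
    (hRx : ∀ τ a i, R τ a → R (τ.setVar x i) a) (hRy : ∀ τ a i, R τ a → R (τ.setVar y i) a)
    (hstep : ∀ i j τ a, (∀ z ∉ c.assigned, z ≠ x → z ≠ y → τ.var z = σ.var z) →
      τ.var x = idx i → τ.var y = idx j → R τ a → R (c.eval n τ) (step (i, j) a))
    {a : α} (h : R σ a) :
    R ((loop m x (loop m y c)).eval n σ) ((l ×ˢ l).foldr step a) := by
  have hfold : (l ×ˢ l).foldr step a =
      l.foldr (fun i a => l.foldr (fun j => step (i, j)) a) a := by
    simp only [SProd.sprod, List.product, List.foldr_flatMap, List.foldr_map]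
  rw [hfold]
  refine loop_induction hl hRx (fun i τ a hτ hi hτa => ?_) h
  refine loop_induction hl hRy (fun j τ' a' hτ' hj hτa' => ?_) hτa
  refine hstep i j τ' a' (fun z hz hzx hzy => ?_) ((hτ' x hx hxy).trans hi) hj hτa'
  exact (hτ' z hz hzy).trans (hτ z hz hzx)

end RAM.Cmd

/-! ### Searches guided by the digits of a number -/

section GuidedSearch

variable {ι α : Type*} (asks : ι → α → Prop) (next : ι → Bool → α → α)

open Classical in
/-- One step of a search whose binary decisions are read off from a number: if `i` asks for a
decision, it is the leading one of the `k` binary digits of the number, where `K = 2 ^ k`, and the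
other digits move up. -/
noncomputable def guidedStep (K : ℕ) (i : ι) (s : α × ℕ) : α × ℕ :=
  if asks i s.1 then
    if 2 * s.2 < K then (next i false s.1, 2 * s.2) else (next i true s.1, 2 * s.2 - K)
  else s

open Classical in
/-- One step of a search whose decisions are made by an oracle; the decisions are counted. -/
noncomputable def oracleStep (o : ι → Bool) (i : ι) (s : α × ℕ) : α × ℕ :=
  if asks i s.1 then (next i (o i) s.1, s.2 + 1) else s

variable {asks next}

theorem exists_guided_eq_oracle_of_dvd {o : ι → Bool} {k : ℕ} {l : List ι} {a : α} {r : ℕ}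
    (hk : (l.foldr (oracleStep asks next o) (a, 0)).2 ≤ k) (hr : r < 2 ^ k)
    (hdvd : 2 ^ (l.foldr (oracleStep asks next o) (a, 0)).2 ∣ r) :
    ∃ u < 2 ^ k, l.foldr (guidedStep asks next (2 ^ k)) (a, u) =
      ((l.foldr (oracleStep asks next o) (a, 0)).1, r) := by
  induction l generalizing r with
  | nil => exact ⟨r, hr, rfl⟩
  | cons i l ih =>
    rw [List.foldr_cons] at hk hdvd ⊢
    set s := l.foldr (oracleStep asks next o) (a, 0)
    by_cases hi : asks i s.1
    · rw [oracleStep, if_pos hi] at hk hdvd ⊢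
      obtain ⟨m, rfl⟩ : ∃ m, k = s.2 + m + 1 := ⟨k - (s.2 + 1), by simp only at hk; lia⟩
      obtain ⟨t, rfl⟩ := hdvd
      have : 2 ^ (s.2 + m + 1) = 2 * (2 ^ s.2 * 2 ^ m) := by ring
      have hstep : 2 ^ (s.2 + 1) * t = 2 * (2 ^ s.2 * t) := by ring
      cases ho : o i
      · obtain ⟨u, hu, heq⟩ := ih (r := 2 ^ s.2 * t) (by lia) (by lia) ⟨t, rfl⟩
        refine ⟨u, hu, ?_⟩
        rw [List.foldr_cons, heq, guidedStep, if_pos hi, if_pos (by lia), hstep]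
      · obtain ⟨u, hu, heq⟩ := ih (r := 2 ^ s.2 * (t + 2 ^ m)) (by lia) (by lia) ⟨_, rfl⟩
        refine ⟨u, hu, ?_⟩
        rw [List.foldr_cons, heq, guidedStep, if_pos hi, if_neg (by lia)]
        exact Prod.ext rfl (by simp only; lia)
    · rw [oracleStep, if_neg hi] at hk hdvd ⊢
      obtain ⟨u, hu, heq⟩ := ih hk hr hdvd
      exact ⟨u, hu, by rw [List.foldr_cons, heq, guidedStep, if_neg hi]⟩

theorem exists_guided_eq_oracle {o : ι → Bool} {k : ℕ} {l : List ι} {a : α}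
    (hk : (l.foldr (oracleStep asks next o) (a, 0)).2 ≤ k) :
    ∃ u < 2 ^ k, (l.foldr (guidedStep asks next (2 ^ k)) (a, u)).1 =
      (l.foldr (oracleStep asks next o) (a, 0)).1 :=
  let ⟨u, hu, heq⟩ := exists_guided_eq_oracle_of_dvd hk (r := 0) (by positivity) (dvd_zero _)
  ⟨u, hu, by rw [heq]⟩

end GuidedSearch

section GuidedCover

variable {V : Type*} [DecidableEq V] (G : SimpleGraph V)

/-- One step of the greedy construction of a vertex cover of `G`: if the pair `p` is an edge that
is not covered yet, one of its ends is added, as decided by the leading digit of the number. -/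
noncomputable def coverStep (K : ℕ) : V × V → Finset V × ℕ → Finset V × ℕ :=
  guidedStep (fun p X => G.Adj p.1 p.2 ∧ p.1 ∉ X ∧ p.2 ∉ X)
    (fun p first X => insert (if first then p.1 else p.2) X) K

/-- The vertex cover to which the greedy construction is guided by `u`. -/
noncomputable def guidedCover (l : List V) (K u : ℕ) : Finset V :=
  ((l ×ˢ l).foldr (coverStep G K) (∅, u)).1

variable {G}

theorem subset_coverStep (K : ℕ) (p : V × V) (s : Finset V × ℕ) :
    s.1 ⊆ (coverStep G K p s).1 := by
  unfold coverStep guidedStep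
  split_ifs
  exacts [subset_insert _ _, subset_insert _ _, Subset.rfl]

theorem mem_coverStep_of_adj (K : ℕ) {p : V × V} (hp : G.Adj p.1 p.2) (s : Finset V × ℕ) :
    p.1 ∈ (coverStep G K p s).1 ∨ p.2 ∈ (coverStep G K p s).1 := by
  unfold coverStep guidedStep
  split_ifs with h
  · simp
  · simp
  · tauto

theorem mem_foldr_coverStep_of_adj (K : ℕ) {l : List (V × V)} {p : V × V} (hp : p ∈ l)
    (hadj : G.Adj p.1 p.2) (s : Finset V × ℕ) :
    p.1 ∈ (l.foldr (coverStep G K) s).1 ∨ p.2 ∈ (l.foldr (coverStep G K) s).1 := by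
  induction hp with
  | head l => exact mem_coverStep_of_adj K hadj _
  | tail q _ ih => exact ih.imp (subset_coverStep K q _ ·) (subset_coverStep K q _ ·)

theorem isVertexCover_guidedCover {l : List V} (hl : ∀ v, v ∈ l) (K u : ℕ) :
    G.IsVertexCover (guidedCover G l K u) := fun v w h =>
  mem_foldr_coverStep_of_adj K (List.pair_mem_product.2 ⟨hl v, hl w⟩) h _

theorem exists_card_guidedCover_le {k : ℕ} {C : Finset V} (hC : G.IsVertexCover C)
    (hk : C.card ≤ k) (l : List V) : ∃ u < 2 ^ k, (guidedCover G l (2 ^ k) u).card ≤ k := by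
  set asks : V × V → Finset V → Prop := fun p X => G.Adj p.1 p.2 ∧ p.1 ∉ X ∧ p.2 ∉ X
  set next : V × V → Bool → Finset V → Finset V :=
    fun p first X => insert (if first then p.1 else p.2) X
  set run := (l ×ˢ l).foldr (oracleStep asks next fun p => p.1 ∈ C) (∅, 0)
  have hrun : run.1 ⊆ C ∧ run.2 = run.1.card := by
    refine List.foldrRecOn (motive := fun s : Finset V × ℕ => s.1 ⊆ C ∧ s.2 = s.1.card)
      (l ×ˢ l) _ (by simp) fun s hs p _ => ?_
    unfold oracleStep
    split_ifs with h
    · have := hC h.1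
      by_cases h1 : p.1 ∈ C <;> simp_all [next, insert_subset_iff, asks]
    · exact hs
  have hcard : run.2 ≤ k := hrun.2 ▸ (card_le_card hrun.1).trans hk
  obtain ⟨u, hu, heq⟩ := exists_guided_eq_oracle hcard
  exact ⟨u, hu, (congrArg Finset.card heq).trans_le (hrun.2 ▸ hcard)⟩

end GuidedCover

section GuidedSubset

variable {V : Type*} [DecidableEq V] (X : Finset V)

/-- One step of the construction of a subset of `X`: if `v` is an element of `X`, the leading digit
of the number decides whether it is added. -/
noncomputable def subsetStep (K : ℕ) : V → Finset V × ℕ → Finset V × ℕ :=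
  guidedStep (fun v _ => v ∈ X) (fun v add S => if add then insert v S else S) K

/-- The subset of `X` to which the construction is guided by `u`. -/
noncomputable def guidedSubset (l : List V) (K u : ℕ) : Finset V :=
  (l.foldr (subsetStep X K) (∅, u)).1

variable {X}

theorem exists_guidedSubset_eq {k : ℕ} (hk : X.card ≤ k) {l : List V} (hl : l.Nodup)
    (hX : ∀ v ∈ X, v ∈ l) {S : Finset V} (hS : S ⊆ X) :
    ∃ u < 2 ^ k, guidedSubset X l (2 ^ k) u = S := by
  set run : List V → Finset V × ℕ := List.foldr (oracleStep (fun v _ => v ∈ X)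
    (fun v add S => if add then insert v S else S) fun v => v ∈ S) (∅, 0)
  have hrun (l : List V) : run l = (l.toFinset ∩ S, (l.filter (· ∈ X)).length) := by
    induction l with
    | nil => simp [run]
    | cons v l ih =>
      change oracleStep _ _ _ v (run l) = _
      rw [ih, oracleStep]
      by_cases hv : v ∈ X
      · by_cases hvS : v ∈ S <;> simp [hv, hvS, insert_inter_of_mem, insert_inter_of_notMem]
      · simp [hv, insert_inter_of_notMem fun h => hv (hS h)]
  have hcard : (run l).2 ≤ k := by
    rw [hrun]
    change (l.filter (· ∈ X)).length ≤ k
    rw [← List.toFinset_card_of_nodup (hl.filter _), List.toFinset_filter]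
    exact (card_le_card fun v hv => by simpa using (mem_filter.1 hv).2).trans hk
  obtain ⟨u, hu, heq⟩ := exists_guided_eq_oracle hcard
  refine ⟨u, hu, heq.trans ?_⟩
  change (run l).1 = S
  rw [hrun, inter_eq_right]
  exact fun v hv => List.mem_toFinset.2 (hX v (hS hv))

end GuidedSubset

/-! ### Satisfiability of implications between literals -/

section Warshall

variable {Λ : Type*}

/-- The relation that Warshall's algorithm computes from `E` with the pivots `l`. -/
def warshall (E : Λ → Λ → Prop) (l : List Λ) : Λ → Λ → Prop :=
  l.foldr (fun k R i j => R i j ∨ R i k ∧ R k j) E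

variable {E : Λ → Λ → Prop} {l : List Λ} {i j k : Λ}

theorem le_warshall (E : Λ → Λ → Prop) (l : List Λ) : E ≤ warshall E l := by
  induction l with
  | nil => exact le_rfl
  | cons k l ih => exact fun i j h => .inl (ih i j h)

theorem warshall_trans_of_mem (hk : k ∈ l) (hik : warshall E l i k) (hkj : warshall E l k j) :
    warshall E l i j := by
  induction l generalizing i j with
  | nil => simp at hk
  | cons a l ih =>
    rcases List.mem_cons.1 hk with rfl | hk
    · exact .inr ⟨hik.elim id And.left, hkj.elim id And.right⟩
    · rcases hik with hik | ⟨hia, hak⟩ <;> rcases hkj with hkj | ⟨hka, haj⟩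
      · exact .inl (ih hk hik hkj)
      · exact .inr ⟨ih hk hik hka, haj⟩
      · exact .inr ⟨hia, ih hk hak hkj⟩
      · exact .inr ⟨hia, haj⟩

theorem transGen_of_warshall (h : warshall E l i j) : Relation.TransGen E i j := by
  induction l generalizing i j with
  | nil => exact .single h
  | cons k l ih =>
    rcases h with h | ⟨h, h'⟩
    exacts [ih h, (ih h).trans (ih h')]

theorem warshall_iff_transGen (hl : ∀ k, k ∈ l) :
    warshall E l i j ↔ Relation.TransGen E i j := by
  refine ⟨transGen_of_warshall, fun h => ?_⟩
  induction h with
  | single h => exact le_warshall E l _ _ h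
  | tail _ h ih => exact warshall_trans_of_mem (hl _) ih (le_warshall E l _ _ h)

end Warshall

section TwoSat

variable {V : Type*}

/-- The literal `(v, b)` stands for the statement that `v` has the truth value `b`; this is its
negation. -/
def negate (p : V × Bool) : V × Bool := (p.1, !p.2)

@[simp]
theorem negate_negate (p : V × Bool) : negate (negate p) = p := by simp [negate]

/-- The assignment `χ` satisfies the implications between literals in `E`. -/
def Satisfies (χ : V → Bool) (E : V × Bool → V × Bool → Prop) : Prop :=
  ∀ p q, E p q → χ p.1 = p.2 → χ q.1 = q.2

/-- The implications in `E` do not force a variable to have both truth values. -/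
def Noncontradictory (E : V × Bool → V × Bool → Prop) : Prop :=
  ∀ v, ¬ (Relation.TransGen E (v, true) (v, false) ∧ Relation.TransGen E (v, false) (v, true))

/-- A partial assignment, given as the set of the literals that it makes true, that is closed
under the implications in `E`. -/
structure IsClosedAssignment (E : V × Bool → V × Bool → Prop) (S : Set (V × Bool)) : Prop where
  closed : ∀ p q, E p q → p ∈ S → q ∈ S
  consistent : ∀ p ∈ S, negate p ∉ S

variable {E : V × Bool → V × Bool → Prop}

theorem Satisfies.noncontradictory {χ : V → Bool} (h : Satisfies χ E) : Noncontradictory E := by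
  have htrans {p q : V × Bool} (hpq : Relation.TransGen E p q) (hp : χ p.1 = p.2) :
      χ q.1 = q.2 := by
    induction hpq with
    | single hE => exact h _ _ hE hp
    | tail _ hE ih => exact h _ _ hE ih
  rintro v ⟨htf, hft⟩
  cases hv : χ v
  · exact Bool.false_ne_true (hv.symm.trans (htrans hft hv))
  · exact Bool.false_ne_true ((htrans htf hv).symm.trans hv)

theorem Noncontradictory.exists_not_transGen (h : Noncontradictory E) (v : V) :
    ∃ b, ¬ Relation.TransGen E (v, b) (negate (v, b)) := by
  by_contra! hcon
  exact h v ⟨hcon true, hcon false⟩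

theorem IsClosedAssignment.mem_of_reflTransGen {S : Set (V × Bool)} (hS : IsClosedAssignment E S)
    {p q : V × Bool} (hp : p ∈ S) (h : Relation.ReflTransGen E p q) : q ∈ S := by
  induction h with
  | refl => exact hp
  | tail _ hE ih => exact hS.closed _ _ hE ih

theorem exists_maximal_isClosedAssignment (E : V × Bool → V × Bool → Prop) :
    ∃ S, Maximal (IsClosedAssignment E) S := by
  refine zorn_subset {S | IsClosedAssignment E S} fun c hc hchain =>
    ⟨⋃₀ c, ⟨fun p q hE ⟨S, hS, hp⟩ => ⟨S, hS, (hc hS).closed p q hE hp⟩, ?_⟩,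
      fun S => Set.subset_sUnion_of_mem⟩
  rintro p ⟨S, hS, hp⟩ ⟨S', hS', hp'⟩
  rcases hchain.total hS hS' with hle | hle
  · exact (hc hS').consistent p (hle hp) hp'
  · exact (hc hS).consistent p hp (hle hp')

variable (hskew : ∀ p q, E p q → E (negate q) (negate p))
include hskew

theorem reflTransGen_negate {p q : V × Bool} (h : Relation.ReflTransGen E p q) :
    Relation.ReflTransGen E (negate q) (negate p) := by
  induction h with
  | refl => rfl
  | tail _ hE ih => exact .head (hskew _ _ hE) ih

theorem IsClosedAssignment.union_reachable {S : Set (V × Bool)} (hS : IsClosedAssignment E S)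
    {p : V × Bool} (hp : negate p ∉ S) (hpp : ¬ Relation.TransGen E p (negate p)) :
    IsClosedAssignment E (S ∪ {q | Relation.ReflTransGen E p q}) where
  closed q r hE hq := hq.imp (hS.closed q r hE) (·.tail hE)
  consistent q hq hq' := by
    have hne : negate p ≠ p := fun h => by simpa [negate] using congrArg Prod.snd h
    -- contraposition of `p → ¬ q` gives `q → ¬ p`, so that `E` leads from `p` through `q` to `¬ p`
    have hboth {q} (hq : Relation.ReflTransGen E p q)
        (hq' : Relation.ReflTransGen E p (negate q)) : False := by
      have hback := reflTransGen_negate hskew hq'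
      rw [negate_negate] at hback
      exact (Relation.reflTransGen_iff_eq_or_transGen.1 (hq.trans hback)).elim hne hpp
    have hcross {q} (hq : q ∈ S) (hq' : Relation.ReflTransGen E p (negate q)) : False := by
      have hback := reflTransGen_negate hskew hq'
      rw [negate_negate] at hback
      exact hp (hS.mem_of_reflTransGen hq hback)
    rcases hq with hq | hq <;> rcases hq' with hq' | hq'
    · exact hS.consistent q hq hq'
    · exact hcross hq hq'
    · exact hcross hq' (by rwa [negate_negate])
    · exact hboth hq hq'

theorem exists_satisfies_iff : (∃ χ, Satisfies χ E) ↔ Noncontradictory E := by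
  classical
  refine ⟨fun ⟨χ, h⟩ => h.noncontradictory, fun h => ?_⟩
  obtain ⟨S, hS⟩ := exists_maximal_isClosedAssignment E
  have htotal (v : V) : ∃ b, (v, b) ∈ S := by
    by_contra! hv
    obtain ⟨b, hb⟩ := h.exists_not_transGen v
    exact hv b (hS.le_of_ge (hS.prop.union_reachable hskew (p := (v, b)) (hv !b) hb)
      Set.subset_union_left (.inr .refl))
  choose χ hχ using htotal
  have hmem (p : V × Bool) : p ∈ S ↔ χ p.1 = p.2 := by
    refine ⟨fun hp => ?_, fun hp => ?_⟩
    · by_contra hne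
      refine hS.prop.consistent p hp ?_
      rw [negate, ← Bool.eq_not.2 hne]
      exact hχ p.1
    · rw [← Prod.mk.eta (p := p), ← hp]
      exact hχ p.1
  exact ⟨χ, fun p q hE hp => (hmem q).1 (hS.prop.closed p q hE ((hmem p).2 hp))⟩

end TwoSat

/-! ### Conflict-free colourings -/

section Colouring

variable {V : Type*}

/-- A 2-colouring of the vertices without two conflicting edges whose ends have different colours;
`C u v x y` means that `uv` and `xy` are conflicting edges. -/
def IsConflictFreeColouring (C : V → V → V → V → Prop) (χ : V → Bool) : Prop :=
  ∀ u v x y, C u v x y → χ u = χ v ∨ χ x = χ y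

/-- The implications that hold in a conflict-free colouring in which `w` has the colour `true`,
`w'` has the colour `false`, and the elements of `X` have the colour `true` if and only if they are
in `S`. An implication from the negation of a literal forces that literal. -/
def ColouringImplies (C : V → V → V → V → Prop) (X S : Finset V) (w w' : V)
    (p q : V × Bool) : Prop :=
  (q = negate p ∧ (q.1 ∈ X ∧ (q.2 = true ↔ q.1 ∈ S) ∨ q = (w, true) ∨ q = (w', false))) ∨
    ∃ u ∈ X, ∃ x ∈ X, C u p.1 x q.1 ∧ ¬ (p.2 = true ↔ u ∈ S) ∧ (q.2 = true ↔ x ∈ S)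

variable {C : V → V → V → V → Prop} {X S : Finset V} {w w' : V}

theorem ColouringImplies.skew (hsymm : ∀ u v x y, C u v x y → C x y u v) (p q : V × Bool)
    (h : ColouringImplies C X S w w' p q) :
    ColouringImplies C X S w w' (negate q) (negate p) := by
  rcases h with ⟨rfl, h⟩ | ⟨u, hu, x, hx, hC, hp, hq⟩
  · exact .inl (by simpa only [negate_negate, true_and] using h)
  · refine .inr ⟨x, hx, u, hu, hsymm _ _ _ _ hC, ?_, ?_⟩
    · simp only [negate, Bool.not_eq_true']
      grind
    · simp only [negate, Bool.not_eq_true']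
      grind

theorem satisfies_colouringImplies_iff {χ : V → Bool} :
    Satisfies χ (ColouringImplies C X S w w') ↔
      ((∀ v ∈ X, χ v = true ↔ v ∈ S) ∧ χ w = true ∧ χ w' = false) ∧
        ∀ u ∈ X, ∀ x ∈ X, ∀ v y, C u v x y → χ u = χ v ∨ χ x = χ y := by
  constructor
  · intro h
    have hforce (q : V × Bool)
        (hq : q.1 ∈ X ∧ (q.2 = true ↔ q.1 ∈ S) ∨ q = (w, true) ∨ q = (w', false)) :
        χ q.1 = q.2 := by
      by_contra hne
      exact hne (h (negate q) q (.inl ⟨(negate_negate q).symm, hq⟩) (Bool.eq_not.2 hne))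
    have hX : ∀ v ∈ X, χ v = true ↔ v ∈ S := fun v hv => by
      classical
      simpa using congrArg (· = true) (hforce (v, decide (v ∈ S)) (.inl ⟨hv, by simp⟩))
    refine ⟨⟨hX, hforce (w, true) (.inr (.inl rfl)), hforce (w', false) (.inr (.inr rfl))⟩, ?_⟩
    intro u hu x hx v y hC
    by_contra! hne
    refine hne.2 (h (v, χ v) (y, χ x) (.inr ⟨u, hu, x, hx, hC, ?_, hX x hx⟩) rfl).symm
    rw [← hX u hu, ← Bool.eq_iff_iff]
    exact hne.1.symm
  · rintro ⟨⟨hX, hw, hw'⟩, hC⟩ p q (⟨-, ⟨hq, hq'⟩ | hq | hq⟩ | ⟨u, hu, x, hx, h, hp', hq⟩) hp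
    · exact Bool.eq_iff_iff.2 ((hX q.1 hq).trans hq'.symm)
    · rw [hq, hw]
    · rw [hq, hw']
    · refine ((hC u hu x hx p.1 q.1 h).resolve_left fun hup => hp' ?_).symm.trans ?_
      · rw [← hp, ← hup, hX u hu]
      · exact Bool.eq_iff_iff.2 ((hX x hx).trans hq.symm)

theorem noncontradictory_colouringImplies_iff (hsymm : ∀ u v x y, C u v x y → C x y u v)
    (hswap : ∀ u v x y, C u v x y → C v u x y) (hX : ∀ u v x y, C u v x y → u ∈ X ∨ v ∈ X) :
    Noncontradictory (ColouringImplies C X S w w') ↔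
      ∃ χ, IsConflictFreeColouring C χ ∧ (∀ v ∈ X, χ v = true ↔ v ∈ S) ∧
        χ w = true ∧ χ w' = false := by
  rw [← exists_satisfies_iff (ColouringImplies.skew hsymm)]
  refine exists_congr fun χ => ?_
  rw [satisfies_colouringImplies_iff, and_comm]
  refine and_congr_left fun _ => ⟨fun h u v x y hC => ?_, fun h u _ x _ v y => h u v x y⟩
  have hleft {u v x y} (hx : x ∈ X) (hC : C u v x y) : χ u = χ v ∨ χ x = χ y := by
    rcases hX _ _ _ _ hC with hu | hv
    · exact h u hu x hx v y hC
    · exact (h v hv x hx u y (hswap _ _ _ _ hC)).imp_left Eq.symm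
  rcases hX _ _ _ _ (hsymm _ _ _ _ hC) with hx | hy
  · exact hleft hx hC
  · exact (hleft hy (hsymm _ _ _ _ (hswap _ _ _ _ (hsymm _ _ _ _ hC)))).imp_right Eq.symm

end Colouring

section Cut

variable {V : Type*}

theorem not_preconnected_iff_exists_colouring {G : SimpleGraph V} :
    ¬ G.Preconnected ↔ ∃ χ : V → Bool, (∃ w w', χ w = true ∧ χ w' = false) ∧
      ∀ u v, G.Adj u v → χ u = χ v := by
  classical
  constructor
  · intro h
    obtain ⟨w, w', hw⟩ : ∃ w w', ¬ G.Reachable w w' := by simpa [SimpleGraph.Preconnected] using h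
    refine ⟨fun v => G.Reachable w v, ⟨w, w', by simp, by simpa using hw⟩, fun u v huv => ?_⟩
    exact decide_eq_decide.2 ⟨(·.trans huv.reachable), (·.trans huv.symm.reachable)⟩
  · rintro ⟨χ, ⟨w, w', hw, hw'⟩, hχ⟩ h
    have hconst {u v : V} (p : G.Walk u v) : χ u = χ v := by
      induction p with
      | nil => rfl
      | cons hadj _ ih => exact (hχ _ _ hadj).trans ih
    exact Bool.false_ne_true (hw'.symm.trans ((hconst (h w w').some).symm.trans hw))

end Cut

namespace ConflictFreeCut.Instance

variable {I : Instance} {u v x y : Fin I.n}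

theorem Conflicting.symm (h : I.Conflicting u v x y) : I.Conflicting x y u v :=
  let ⟨h, h', hc⟩ := h
  ⟨h', h, hc.symm⟩

theorem Conflicting.swap (h : I.Conflicting u v x y) : I.Conflicting v u x y := by
  obtain ⟨h, h', hc⟩ := h
  refine ⟨h.symm, h', ?_⟩
  convert hc using 2
  exact Subtype.ext Sym2.eq_swap

theorem hasConflictFreeCut_iff (I : Instance) :
    I.HasConflictFreeCut ↔ ∃ χ, IsConflictFreeColouring I.Conflicting χ ∧
      ∃ w w', χ w = true ∧ χ w' = false := by
  have : Nonempty (Fin I.n) := I.connected.nonempty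
  simp only [HasConflictFreeCut, IsConflictFreeCut, SimpleGraph.connected_iff, this, and_true,
    not_preconnected_iff_exists_colouring]
  constructor
  · rintro ⟨F, ⟨χ, hw, hχ⟩, hF⟩
    have hmem {u v} (h : I.G.Adj u v) (hne : χ u ≠ χ v) : (⟨s(u, v), h⟩ : I.G.edgeSet) ∈ F := by
      by_contra hF
      refine hne (hχ u v (SimpleGraph.deleteEdges_adj.2 ⟨h, ?_⟩))
      rintro ⟨e, he, he'⟩
      exact hF (by convert he; exact Subtype.ext he'.symm)
    refine ⟨χ, fun u v x y ⟨h, h', hc⟩ => ?_, hw⟩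
    by_contra! hne
    exact hF (hmem h hne.1) (hmem h' hne.2) hc.ne hc
  · rintro ⟨χ, hχ, hw⟩
    refine ⟨{e | ∃ u v, e.1 = s(u, v) ∧ χ u ≠ χ v}, ⟨χ, hw, fun u v h => ?_⟩, ?_⟩
    · rw [SimpleGraph.deleteEdges_adj] at h
      by_contra hne
      exact h.2 ⟨⟨s(u, v), h.1⟩, ⟨u, v, rfl, hne⟩, rfl⟩
    · rintro ⟨e, he⟩ ⟨u, v, rfl, huv⟩ ⟨f, hf⟩ ⟨x, y, rfl, hxy⟩ - hadj
      exact (hχ u v x y ⟨he, hf, hadj⟩).elim huv hxy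

theorem exists_isVertexCover_card_eq (I : Instance) :
    ∃ C : Finset (Fin I.n), I.G.IsVertexCover C ∧ C.card = I.vertexCoverNumber := by
  classical
  obtain ⟨s, hs, hcover⟩ := I.G.vertexCoverNum_exists
  refine ⟨s.toFinset, by simpa using hcover, ?_⟩
  rw [vertexCoverNumber, ← hs, Set.encard_eq_coe_toFinset_card]
  rfl

theorem hasConflictFreeCut_iff_exists_guidedSubset (I : Instance) {X : Finset (Fin I.n)} {k : ℕ}
    (hX : I.G.IsVertexCover X) (hk : X.card ≤ k) :
    I.HasConflictFreeCut ↔ ∃ u < 2 ^ k, ∃ w w', Noncontradictory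
      (ColouringImplies I.Conflicting X (guidedSubset X (List.finRange I.n) (2 ^ k) u) w w') := by
  classical
  have hcover : ∀ u v x y, I.Conflicting u v x y → u ∈ X ∨ v ∈ X := fun _ _ _ _ h => hX h.1
  simp only [hasConflictFreeCut_iff, noncontradictory_colouringImplies_iff
    (fun u v x y => Conflicting.symm (u := u) (v := v) (x := x) (y := y))
    (fun _ _ _ _ => Conflicting.swap) hcover]
  constructor
  · rintro ⟨χ, hχ, w, w', hw⟩
    obtain ⟨u, hu, heq⟩ := exists_guidedSubset_eq hk (List.nodup_finRange I.n)
      (fun v _ => List.mem_finRange v) (filter_subset (χ · = true) X)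
    exact ⟨u, hu, w, w', χ, hχ, fun v hv => by simp [heq, hv], hw⟩
  · rintro ⟨u, -, w, w', χ, hχ, -, hw⟩
    exact ⟨χ, hχ, w, w', hw⟩

end ConflictFreeCut.Instance

/-! ### The encoding of the instances -/

theorem getElem?_append_ofFn {α : Type*} {l : List α} {m a : ℕ} (f : Fin m → α) (i : Fin m)
    (h : l.length = a) : (l ++ List.ofFn f)[a + i]? = some (f i) := by
  subst h
  rw [List.getElem?_append_right (Nat.le_add_right ..), Nat.add_sub_cancel_left]
  simp

namespace ConflictFreeCut.Instance

open RAM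

variable (I : Instance)

theorem length_encode : I.encode.length = I.n + 1 + I.n * I.n + I.n * I.n * (I.n * I.n) := by
  simp only [encode, List.length_append, List.length_replicate, List.length_singleton,
    List.length_ofFn]

theorem getElem?_encode_of_lt {i : ℕ} (hi : i < I.n) : I.encode[i]? = some true := by
  rw [encode, List.append_assoc, List.append_assoc, List.getElem?_append_left (by simpa using hi)]
  simp [hi]

theorem getElem?_encode_n : I.encode[I.n]? = some false := by
  rw [encode, List.append_assoc, List.append_assoc, List.getElem?_append_right (by simp)]
  simp

open Classical in
theorem getElem?_encode_adj (u v : Fin I.n) :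
    I.encode[I.n + 1 + (I.n * u + v)]? = some (decide (I.G.Adj u v)) := by
  change I.encode[I.n + 1 + (Fin.mkDivMod u v).1]? = _
  rw [encode, List.getElem?_append_left, getElem?_append_ofFn _ _ (by simp)]
  · simp
  · rw [List.length_append, List.length_ofFn]
    simpa using (Fin.mkDivMod u v).isLt

open Classical in
theorem getElem?_encode_conflict (u v x y : Fin I.n) :
    I.encode[I.n + 1 + I.n * I.n + (I.n * I.n * (I.n * u + v) + (I.n * x + y))]? =
      some (decide (I.Conflicting u v x y)) := by
  change I.encode[I.n + 1 + I.n * I.n +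
    (Fin.mkDivMod (Fin.mkDivMod u v) (Fin.mkDivMod x y)).1]? = _
  rw [encode, getElem?_append_ofFn _ _ (by simp; lia)]
  simp

/-- The memory `μ` holds the encoding of the instance `I` in its first cells. -/
def IsInput (μ : ℕ → ℕ) : Prop :=
  Set.EqOn μ (State.start I.encode).mem (Set.Iio I.encode.length)

variable {I} {μ μ' : ℕ → ℕ}

theorem IsInput.ne_zero_iff (h : I.IsInput μ) {i : ℕ} {b : Bool} (hb : I.encode[i]? = some b) :
    μ i ≠ 0 ↔ b = true := by
  rw [h (List.getElem?_eq_some_iff.1 hb).1]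
  cases b <;> simp [State.start, hb]

theorem IsInput.adj_iff (h : I.IsInput μ) (u v : Fin I.n) :
    μ (I.n + 1 + (I.n * u + v)) ≠ 0 ↔ I.G.Adj u v := by
  classical
  rw [h.ne_zero_iff (I.getElem?_encode_adj u v), decide_eq_true_iff]

theorem IsInput.conflicting_iff (h : I.IsInput μ) (u v x y : Fin I.n) :
    μ (I.n + 1 + I.n * I.n + (I.n * I.n * (I.n * u + v) + (I.n * x + y))) ≠ 0 ↔
      I.Conflicting u v x y := by
  classical
  rw [h.ne_zero_iff (I.getElem?_encode_conflict u v x y), decide_eq_true_iff]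

end ConflictFreeCut.Instance

/-! ### The algorithm -/

namespace ConflictFreeCut

open RAM

/-- The variables of the algorithm. The memory from `free` on is not used by the input: it holds a
vertex cover (from `free` on), a set of vertices (from `free + size` on), and then matrices that are
indexed by literals, the current one from `base` on. -/
inductive Var
  | free | size | limit | budget | code | bits | flag | answer | base | target
  | pivot | p | q | u | v | w | w' | i
  deriving DecidableEq, Encodable

section Program

open Var

/-- The `n`-fold value of an expression. -/
def scale (e : Expr Var) : Expr Var := .sum 1 i e

/-- The vertex of the literal with index `x`. -/
def vertex (x : Var) : Expr Var := .ite (.lt x size) x (x - size)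

/-- The truth value of the literal with index `x`. -/
def sign (x : Var) : Expr Var := .not (.lt x size)

/-- Membership in the vertex cover. -/
def inCover (e : Expr Var) : Expr Var := .load (free + e)

/-- Membership in the set of vertices that is stored behind the vertex cover. -/
def inSubset (e : Expr Var) : Expr Var := .load (free + size + e)

/-- `u` and `v` are adjacent. -/
def adjacent : Expr Var := .load (size + 1 + (scale u + v))

/-- The edge from `u` to the vertex of `p` and the edge from `v` to the vertex of `q` are in
conflict. -/
def conflict : Expr Var :=
  .load (size + 1 + scale size + (scale (scale (scale u + vertex p)) + (scale v + vertex q)))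

/-- The literal `q` is forced, and `p` is its negation. -/
def forcing : Expr Var :=
  .and (.or (.eq q (p + size)) (.eq p (q + size)))
    (.or (.and (inCover (vertex q)) (.iff (sign q) (inSubset (vertex q))))
      (.or (.eq q (w + size)) (.eq q w')))

/-- If `p` holds, then an edge from the cover has differently coloured ends; if `q` does not hold,
then so does an edge that is in conflict with it. -/
def clashing : Expr Var :=
  .sum 1 u (.sum 1 v (.and (inCover u) (.and (inCover v) (.and conflict
    (.and (.not (.iff (sign p) (inSubset u))) (.iff (sign q) (inSubset v)))))))

/-- The relation `ColouringImplies` between the literals `p` and `q`. -/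
def implication : Expr Var := .or forcing clashing

/-- The position of the entry with the given row and column in a matrix. -/
def position (e e' : Expr Var) : Expr Var := .sum 2 i e + e'

/-- The entry of the current matrix with the given row and column. -/
def entry (e e' : Expr Var) : Expr Var := .load (base + position e e')

/-- The current matrix leads from some literal to its negation and back. -/
def contradictory : Expr Var := .sum 1 v (.and (entry (v + size) v) (entry v (v + size)))

/-- Follow the leading digit of `bits`, if the condition `e` holds. -/
def guided (e : Expr Var) (c c' : Cmd Var) : Cmd Var :=
  .ite e
    (.ite (.lt (bits + bits) budget)
      (.seq (.assign bits (bits + bits)) c)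
      (.seq (.assign bits (bits + bits - budget)) c'))
    .skip

/-- Add the vertex `x` to the set that starts at `target`. -/
def mark (x : Var) : Cmd Var := .store (target + x) 1

/-- Start with the empty set at `e` and with all digits of `code`. -/
def clear (e : Expr Var) : Cmd Var :=
  .seq (.assign bits code) (.seq (.assign target e) (.loop 1 v (.store (target + v) 0)))

/-- Build the vertex cover `guidedCover`. -/
def buildCover : Cmd Var :=
  .seq (clear free) (.loop 1 u (.loop 1 v
    (guided (.and adjacent (.and (.not (inCover u)) (.not (inCover v)))) (mark v) (mark u))))

/-- Build the set `guidedSubset`. -/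
def buildSubset : Cmd Var :=
  .seq (clear (free + size)) (.loop 1 v (guided (inCover v) .skip (mark v)))

/-- Store the matrix with the entries `e` from `target` on. -/
def fill (e : Expr Var) : Cmd Var :=
  .loop 2 p (.loop 2 q (.store (target + position p q) e))

/-- Replace the current matrix by the one with the entries `e`, which is stored behind it. -/
def layer (e : Expr Var) : Cmd Var :=
  .seq (fill e) (.seq (.assign base target) (.assign target (target + .sum 2 i (.sum 2 i 1))))

/-- There is an edge from `p` to `q`, or a path of two edges through `pivot`. -/
def shortcut : Expr Var := .or (entry p q) (.and (entry p pivot) (entry pivot q))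

/-- Compute the transitive closure of the implications by Warshall's algorithm. -/
def closure : Cmd Var :=
  .seq (.assign target (free + size + size))
    (.seq (layer implication) (.loop 2 pivot (layer shortcut)))

/-- Set `answer` to `1` if some conflict-free colouring restricts to the current set of vertices on
the vertex cover and separates `w` from `w'`. -/
def trySeparating : Cmd Var :=
  .seq closure (.ite contradictory .skip (.assign answer 1))

/-- Set `answer` to `1` if some conflict-free colouring with two colours restricts to `guidedSubset`
on the vertex cover. -/
def tryColourings : Cmd Var :=
  .seq buildSubset (.loop 1 w (.loop 1 w' trySeparating))

end Program

/-! ### Sets and matrices in the memory -/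

section Memory

variable {n B : ℕ} {μ μ' : ℕ → ℕ}

/-- The memory `μ` holds the indicator function of `X` from the cell `B` on. -/
def IsIndicator (B : ℕ) (μ : ℕ → ℕ) (X : Finset (Fin n)) : Prop :=
  ∀ v : Fin n, μ (B + v) = if v ∈ X then 1 else 0

theorem IsIndicator.ne_zero_iff {X : Finset (Fin n)} (h : IsIndicator B μ X) (v : Fin n) :
    μ (B + v) ≠ 0 ↔ v ∈ X := by
  simp [h v]

theorem IsIndicator.sum_eq_card {X : Finset (Fin n)} (h : IsIndicator B μ X) :
    ∑ v ∈ range n, μ (B + v) = X.card := by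
  simp [sum_range fun v => μ (B + v), h _]

theorem IsIndicator.insert {X : Finset (Fin n)} (h : IsIndicator B μ X) (v : Fin n) :
    IsIndicator B (Function.update μ (B + v) 1) (insert v X) := fun w => by
  by_cases hw : w = v
  · simp [hw]
  · simp [h w, hw, Fin.val_inj]

theorem IsIndicator.congr {X : Finset (Fin n)} (h : IsIndicator B μ X)
    (hμ : Set.EqOn μ' μ (Set.Iio (B + n))) : IsIndicator B μ' X := fun v =>
  (hμ (Nat.add_lt_add_left v.isLt B)).trans (h v)

/-- The index of a literal in a matrix. -/
def literalIndex (a : Fin n × Bool) : ℕ := a.1 + if a.2 then n else 0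

/-- The literals in the order of their indices. -/
def literals (n : ℕ) : List (Fin n × Bool) :=
  (List.finRange n).map (·, false) ++ (List.finRange n).map (·, true)

theorem map_literalIndex_literals (n : ℕ) :
    (literals n).map literalIndex = List.range (2 * n) := by
  rw [two_mul, List.range_add, ← List.map_coe_finRange_eq_range, List.map_map]
  simp [literals, literalIndex, Function.comp_def, add_comm n, -List.map_coe_finRange_eq_range]

theorem mem_literals (a : Fin n × Bool) : a ∈ literals n := by
  obtain ⟨v, _ | _⟩ := a <;> simp [literals]

theorem literalIndex_lt (a : Fin n × Bool) : literalIndex a < 2 * n := by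
  unfold literalIndex; split_ifs <;> lia

theorem literalIndex_eq_val_iff {a : Fin n × Bool} {v : Fin n} :
    literalIndex a = v ↔ a = (v, false) := by
  obtain ⟨w, _ | _⟩ := a <;> simp [literalIndex, Fin.ext_iff]; lia

theorem literalIndex_eq_val_add_iff {a : Fin n × Bool} {v : Fin n} :
    literalIndex a = v + n ↔ a = (v, true) := by
  obtain ⟨w, _ | _⟩ := a <;> simp [literalIndex, Fin.ext_iff]; lia

theorem literalIndex_negate_iff {a b : Fin n × Bool} :
    literalIndex b = literalIndex a + n ∨ literalIndex a = literalIndex b + n ↔ b = negate a := by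
  obtain ⟨v, _ | _⟩ := a <;> obtain ⟨w, _ | _⟩ := b <;>
    simp [literalIndex, negate, Fin.ext_iff] <;> lia

theorem literalIndex_injective : Function.Injective (literalIndex (n := n)) := by
  rintro ⟨v, _ | _⟩ ⟨w, _ | _⟩ h <;> simp [literalIndex] at h ⊢ <;> lia

/-- The position of an entry in a matrix. -/
def entryIndex (a b : Fin n × Bool) : ℕ := 2 * n * literalIndex a + literalIndex b

theorem entryIndex_lt (a b : Fin n × Bool) : entryIndex a b < 2 * n * (2 * n) := by
  have := Nat.mul_le_mul_left (2 * n) (Nat.succ_le_of_lt (literalIndex_lt a))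
  have := literalIndex_lt b
  unfold entryIndex; lia

theorem entryIndex_inj {a b a' b' : Fin n × Bool} :
    entryIndex a b = entryIndex a' b' ↔ a = a' ∧ b = b' := by
  refine ⟨fun h => ?_, fun ⟨ha, hb⟩ => by rw [ha, hb]⟩
  have hmod := congrArg (· % (2 * n)) h
  simp only [entryIndex, Nat.mul_add_mod, Nat.mod_eq_of_lt (literalIndex_lt _)] at hmod
  have hn : 0 < 2 * n := (literalIndex_lt a).pos
  refine ⟨literalIndex_injective ?_, literalIndex_injective hmod⟩
  rw [entryIndex, entryIndex, hmod] at h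
  exact Nat.eq_of_mul_eq_mul_left hn (Nat.add_right_cancel h)

/-- The memory `μ` holds the matrix of the relation `E` from the cell `B` on. -/
def IsMatrix (B : ℕ) (μ : ℕ → ℕ) (E : Fin n × Bool → Fin n × Bool → Prop) : Prop :=
  ∀ a b, μ (B + entryIndex a b) ≠ 0 ↔ E a b

theorem IsMatrix.congr {E : Fin n × Bool → Fin n × Bool → Prop} (h : IsMatrix B μ E)
    (hμ : Set.EqOn μ' μ (Set.Iio (B + 2 * n * (2 * n)))) : IsMatrix B μ' E := fun a b => by
  rw [hμ (Nat.add_lt_add_left (entryIndex_lt a b) B), h a b]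

end Memory

/-! ### Correctness of the expressions -/

variable {I : Instance} {σ τ : Store Var}

/-- The constants of the algorithm have been computed and the input is in the memory. -/
structure Ready (I : Instance) (σ : Store Var) : Prop where
  free : σ.var .free = I.encode.length
  size : σ.var .size = I.n
  input : I.IsInput σ.mem

theorem Ready.congr (h : Ready I σ) (hfree : τ.var .free = σ.var .free)
    (hsize : τ.var .size = σ.var .size)
    (hmem : Set.EqOn τ.mem σ.mem (Set.Iio I.encode.length)) : Ready I τ :=
  ⟨hfree.trans h.free, hsize.trans h.size, hmem.trans h.input⟩

section Expressions

variable {x : Var} {a b : Fin I.n × Bool} {X S : Finset (Fin I.n)}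

theorem eval_vertex (hsize : σ.var .size = I.n) (hx : σ.var x = literalIndex a) :
    (vertex x).eval I.n σ = a.1 := by
  have : (vertex x).eval I.n σ = if literalIndex a < I.n then literalIndex a else
      literalIndex a - I.n := by
    simp only [vertex, Expr.eval, ← hx, ← hsize]
    congr 1
    exact propext Expr.holds_lt
  rw [this]
  unfold literalIndex
  split_ifs <;> lia

theorem holds_sign (hsize : σ.var .size = I.n) (hx : σ.var x = literalIndex a) :
    (sign x).Holds I.n σ ↔ a.2 = true := by
  simp only [sign, Expr.holds_not, Expr.holds_lt, Expr.eval_var, hsize, hx, literalIndex]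
  grind

theorem holds_adjacent (h : Ready I σ) {u v : Fin I.n} (hu : σ.var .u = u) (hv : σ.var .v = v) :
    adjacent.Holds I.n σ ↔ I.G.Adj u v := by
  simpa [adjacent, scale, Expr.eval, h.size, hu, hv] using h.input.adj_iff u v

theorem holds_conflict (h : Ready I σ) {u v : Fin I.n} (hu : σ.var .u = u) (hv : σ.var .v = v)
    (hp : σ.var .p = literalIndex a) (hq : σ.var .q = literalIndex b) :
    conflict.Holds I.n σ ↔ I.Conflicting u a.1 v b.1 := by
  have hvertex (j : ℕ) : (vertex .p).eval I.n (σ.setVar .i j) = a.1 :=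
    eval_vertex (by simpa using h.size) (by simpa using hp)
  rw [← h.input.conflicting_iff]
  simp [conflict, scale, Expr.eval, h.size, hu, hv, eval_vertex h.size hq, hvertex, mul_assoc]

theorem holds_inCover (h : Ready I σ) (hX : IsIndicator I.encode.length σ.mem X) {e : Expr Var}
    {v : Fin I.n} (he : e.eval I.n σ = v) : (inCover e).Holds I.n σ ↔ v ∈ X := by
  simpa [inCover, h.free, he] using hX.ne_zero_iff v

theorem holds_inSubset (h : Ready I σ) (hS : IsIndicator (I.encode.length + I.n) σ.mem S)
    {e : Expr Var} {v : Fin I.n} (he : e.eval I.n σ = v) :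
    (inSubset e).Holds I.n σ ↔ v ∈ S := by
  simpa [inSubset, h.free, h.size, he] using hS.ne_zero_iff v

theorem holds_forcing (h : Ready I σ) (hX : IsIndicator I.encode.length σ.mem X)
    (hS : IsIndicator (I.encode.length + I.n) σ.mem S) {w w' : Fin I.n} (hw : σ.var .w = w)
    (hw' : σ.var .w' = w') (hp : σ.var .p = literalIndex a) (hq : σ.var .q = literalIndex b) :
    forcing.Holds I.n σ ↔
      b = negate a ∧ (b.1 ∈ X ∧ (b.2 = true ↔ b.1 ∈ S) ∨ b = (w, true) ∨ b = (w', false)) := by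
  simp [forcing, holds_inCover h hX (eval_vertex h.size hq), holds_sign h.size hq,
    holds_inSubset h hS (eval_vertex h.size hq), h.size, hw, hw', hp, hq, literalIndex_negate_iff,
    literalIndex_eq_val_iff, literalIndex_eq_val_add_iff]

theorem holds_clashing (h : Ready I σ) (hX : IsIndicator I.encode.length σ.mem X)
    (hS : IsIndicator (I.encode.length + I.n) σ.mem S) (hp : σ.var .p = literalIndex a)
    (hq : σ.var .q = literalIndex b) :
    clashing.Holds I.n σ ↔ ∃ u ∈ X, ∃ x ∈ X, I.Conflicting u a.1 x b.1 ∧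
      ¬ (a.2 = true ↔ u ∈ S) ∧ (b.2 = true ↔ x ∈ S) := by
  simp only [clashing, Expr.holds_sum_one]
  refine exists_congr fun u => (exists_congr fun x => ?_).trans exists_and_left
  set τ := (σ.setVar .u u).setVar .v x
  have hτ : Ready I τ := h.congr (by simp [τ]) (by simp [τ]) fun _ _ => rfl
  have hu : (Expr.var .u).eval I.n τ = u := by simp [τ]
  have hx : (Expr.var .v).eval I.n τ = x := by simp [τ]
  have hp : τ.var .p = literalIndex a := by simpa [τ] using hp
  have hq : τ.var .q = literalIndex b := by simpa [τ] using hq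
  simp only [Expr.holds_and, Expr.holds_not, Expr.holds_iff, holds_inCover hτ hX hu,
    holds_inCover hτ hX hx, holds_inSubset hτ hS hu, holds_inSubset hτ hS hx,
    holds_conflict hτ hu hx hp hq, holds_sign hτ.size hp, holds_sign hτ.size hq]

theorem holds_implication (h : Ready I σ) (hX : IsIndicator I.encode.length σ.mem X)
    (hS : IsIndicator (I.encode.length + I.n) σ.mem S) {w w' : Fin I.n} (hw : σ.var .w = w)
    (hw' : σ.var .w' = w') (hp : σ.var .p = literalIndex a) (hq : σ.var .q = literalIndex b) :
    implication.Holds I.n σ ↔ ColouringImplies I.Conflicting X S w w' a b := by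
  rw [implication, Expr.holds_or, holds_forcing h hX hS hw hw' hp hq,
    holds_clashing h hX hS hp hq, ColouringImplies]

theorem eval_position {n : ℕ} {a b : Fin n × Bool} {e e' : Expr Var}
    (he : ∀ j, e.eval n (σ.setVar .i j) = literalIndex a) (he' : e'.eval n σ = literalIndex b) :
    (position e e').eval n σ = entryIndex a b := by
  simp [position, Expr.eval, he, he', entryIndex]

theorem holds_entry {n B : ℕ} {a b : Fin n × Bool} {E : Fin n × Bool → Fin n × Bool → Prop}
    {e e' : Expr Var} (hB : σ.var .base = B) (h : IsMatrix B σ.mem E)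
    (he : ∀ j, e.eval n (σ.setVar .i j) = literalIndex a) (he' : e'.eval n σ = literalIndex b) :
    (entry e e').Holds n σ ↔ E a b := by
  rw [← h a b, entry, Expr.holds_load, Expr.eval_add, Expr.eval_var, hB, eval_position he he']

theorem holds_contradictory {B : ℕ} {E : Fin I.n × Bool → Fin I.n × Bool → Prop}
    (hsize : σ.var .size = I.n) (hB : σ.var .base = B)
    (h : IsMatrix B σ.mem (Relation.TransGen E)) :
    contradictory.Holds I.n σ ↔ ¬ Noncontradictory E := by
  have hindex (v : Fin I.n) (c : Bool) :
      literalIndex (v, c) = v + if c then I.n else 0 := rfl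
  simp only [contradictory, Expr.holds_sum_one, Noncontradictory, not_forall, not_not,
    Expr.holds_and]
  refine exists_congr fun v => and_congr ?_ ?_
  · exact holds_entry (by simpa using hB) h (by simp [hsize, hindex]) (by simp [hindex])
  · exact holds_entry (by simpa using hB) h (by simp [hindex]) (by simp [hsize, hindex])

end Expressions

/-! ### Correctness of the commands -/

theorem map_val_finRange (n : ℕ) : (List.finRange n).map Fin.val = List.range (1 * n) := by
  rw [one_mul, List.map_coe_finRange_eq_range]

section Build

variable {n B : ℕ} {μ : ℕ → ℕ} {X : Finset (Fin n)}

/-- A state of the construction of a set that starts at `B`; the second component of `s` is the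
number whose digits guide the construction. Below `B` the memory is that of `μ`. -/
structure Builds (μ : ℕ → ℕ) (B : ℕ) (σ : Store Var) (s : Finset (Fin n) × ℕ) : Prop where
  target : σ.var .target = B
  bits : σ.var .bits = s.2
  indicator : IsIndicator B σ.mem s.1
  eqOn : Set.EqOn σ.mem μ (Set.Iio B)

theorem Builds.setVar {s : Finset (Fin n) × ℕ} (h : Builds μ B σ s) {x : Var} (hx : x ≠ .target)
    (hx' : x ≠ .bits) (a : ℕ) : Builds μ B (σ.setVar x a) s :=
  ⟨by simpa [hx.symm] using h.target, by simpa [hx'.symm] using h.bits, h.indicator, h.eqOn⟩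

theorem Builds.mark {b : ℕ} (h : Builds μ B σ (X, b)) {x : Var} {v : Fin n} (hx : σ.var x = v) :
    Builds μ B ((mark x).eval n σ) (insert v X, b) := by
  have heval : (ConflictFreeCut.mark x).eval n σ = σ.setMem (B + v) 1 := by
    simp [ConflictFreeCut.mark, Cmd.eval, h.target, hx]
  rw [heval]
  refine ⟨h.target, h.bits, h.indicator.insert v, fun i hi => ?_⟩
  rw [Store.mem_setMem, if_neg ((Set.mem_Iio.1 hi).trans_le (Nat.le_add_right ..)).ne, h.eqOn hi]

theorem Builds.guided {ι : Type*} {asks : ι → Finset (Fin n) → Prop}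
    {next : ι → Bool → Finset (Fin n) → Finset (Fin n)} {e : Expr Var} {c c' : Cmd Var} {i : ι}
    {s : Finset (Fin n) × ℕ} (h : Builds μ B σ s) (he : e.Holds n σ ↔ asks i s.1)
    (hc : ∀ b, Builds μ B (σ.setVar .bits b) (s.1, b) →
      Builds μ B (c.eval n (σ.setVar .bits b)) (next i false s.1, b))
    (hc' : ∀ b, Builds μ B (σ.setVar .bits b) (s.1, b) →
      Builds μ B (c'.eval n (σ.setVar .bits b)) (next i true s.1, b)) :
    Builds μ B ((guided e c c').eval n σ) (guidedStep asks next (σ.var .budget) i s) := by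
  have hbits (b : ℕ) : Builds μ B (σ.setVar .bits b) (s.1, b) :=
    ⟨h.target, by simp, h.indicator, h.eqOn⟩
  have hlt : (Expr.lt (Expr.var Var.bits + Expr.var Var.bits) Var.budget).Holds n σ ↔
      2 * s.2 < σ.var .budget := by
    simp [h.bits, two_mul]
  rw [ConflictFreeCut.guided]
  unfold guidedStep
  split_ifs with hasks hdigit
  · rw [Cmd.eval_ite_of_holds (he.2 hasks), Cmd.eval_ite_of_holds (hlt.2 hdigit)]
    simpa [Cmd.eval, h.bits, two_mul] using hc _ (hbits (2 * s.2))
  · rw [Cmd.eval_ite_of_holds (he.2 hasks), Cmd.eval_ite_of_not_holds (hdigit ∘ hlt.1)]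
    simpa [Cmd.eval, h.bits, two_mul] using hc' _ (hbits (2 * s.2 - σ.var .budget))
  · rw [Cmd.eval_ite_of_not_holds (hasks ∘ he.1)]
    exact h

theorem builds_clear {e : Expr Var} (he : e.eval n (σ.setVar .bits (σ.var .code)) = B) :
    Builds σ.mem B ((clear e).eval n σ) ((∅ : Finset (Fin n)), σ.var .code) := by
  have hloop := Cmd.loop_induction (c := .store (Expr.var .target + Expr.var .v) 0)
    (x := .v) (map_val_finRange n) (step := List.cons) (a := [])
    (σ := (σ.setVar .bits (σ.var .code)).setVar .target B)
    (R := fun τ (done : List (Fin n)) => τ.var .target = B ∧ τ.var .bits = σ.var .code ∧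
      Set.EqOn τ.mem σ.mem (Set.Iio B) ∧ ∀ v ∈ done, τ.mem (B + v) = 0)
    (fun τ _ i h => by simpa using h) ?_ (by simp [Set.EqOn])
  · rw [List.foldr_cons_nil] at hloop
    obtain ⟨htarget, hbits, heq, hzero⟩ := hloop
    rw [← he] at htarget hbits heq hzero ⊢
    exact ⟨htarget, hbits, fun v => (hzero v (List.mem_finRange v)).trans
      (if_neg (notMem_empty v)).symm, heq⟩
  · rintro v τ done - hv ⟨htarget, hbits, heq, hzero⟩
    have heval : (Cmd.store (Expr.var .target + Expr.var .v) 0).eval n τ =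
        τ.setMem (B + v) 0 := by
      simp [Cmd.eval, htarget, hv]
    rw [heval]
    refine ⟨htarget, hbits, fun i hi => ?_, fun w hw => ?_⟩
    · rw [Store.mem_setMem, if_neg ((Set.mem_Iio.1 hi).trans_le (Nat.le_add_right ..)).ne, heq hi]
    · rw [Store.mem_setMem]
      split_ifs with hwv
      · rfl
      · exact hzero w ((List.mem_cons.1 hw).resolve_left fun h => hwv (by rw [h]))

theorem builds_buildCover (h : Ready I σ) :
    Builds σ.mem I.encode.length (buildCover.eval I.n σ)
      (((List.finRange I.n) ×ˢ (List.finRange I.n)).foldr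
        (coverStep I.G (σ.var .budget)) (∅, σ.var .code)) := by
  have hstart := builds_clear (n := I.n) (e := Var.free) (σ := σ) (B := I.encode.length)
    (by simpa using h.free)
  refine Cmd.loop_loop_induction (by decide) (by decide) (map_val_finRange I.n)
    (R := Builds σ.mem I.encode.length) (fun τ a i h => h.setVar (by decide) (by decide) i)
    (fun τ a i h => h.setVar (by decide) (by decide) i) (fun u v τ s hτ hu hv hs => ?_) hstart
  have hvar {x : Var} (hx : x ∉ buildCover.assigned) (hxu : x ≠ .u) (hxv : x ≠ .v) :
      τ.var x = σ.var x := by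
    simp only [buildCover, Cmd.assigned, notMem_union] at hx
    exact (hτ x hx.2 hxu hxv).trans (Cmd.var_eval_of_notMem hx.1)
  have hτready : Ready I τ := h.congr (hvar (by decide) (by decide) (by decide))
    (hvar (by decide) (by decide) (by decide)) hs.eqOn
  rw [← hvar (x := .budget) (by decide) (by decide) (by decide)]
  have hu' : (Expr.var .u).eval I.n τ = u := hu
  have hv' : (Expr.var .v).eval I.n τ = v := hv
  refine hs.guided ?_ (fun b hb => hb.mark (by simpa using hv))
    (fun b hb => hb.mark (by simpa using hu))
  simp only [Expr.holds_and, Expr.holds_not, holds_adjacent hτready hu hv,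
    holds_inCover hτready hs.indicator hu', holds_inCover hτready hs.indicator hv']

theorem builds_buildSubset (h : Ready I σ) {X : Finset (Fin I.n)}
    (hX : IsIndicator I.encode.length σ.mem X) :
    Builds σ.mem (I.encode.length + I.n) (buildSubset.eval I.n σ)
      ((List.finRange I.n).foldr (subsetStep X (σ.var .budget)) (∅, σ.var .code)) := by
  have hstart := builds_clear (n := I.n) (e := Var.free + Var.size) (σ := σ)
    (B := I.encode.length + I.n) (by simp [h.free, h.size])
  refine Cmd.loop_induction (map_val_finRange I.n) (R := Builds σ.mem (I.encode.length + I.n))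
    (fun τ a i h => h.setVar (by decide) (by decide) i) (fun v τ s hτ hv hs => ?_) hstart
  have hvar {x : Var} (hx : x ∉ buildSubset.assigned) (hxv : x ≠ .v) :
      τ.var x = σ.var x := by
    simp only [buildSubset, Cmd.assigned, notMem_union] at hx
    exact (hτ x hx.2 hxv).trans (Cmd.var_eval_of_notMem hx.1)
  have hτready : Ready I τ := h.congr (hvar (by decide) (by decide))
    (hvar (by decide) (by decide)) (hs.eqOn.mono (Set.Iio_subset_Iio (by lia)))
  rw [← hvar (x := .budget) (by decide) (by decide)]
  exact hs.guided (holds_inCover hτready (hX.congr hs.eqOn) hv) (fun b hb => hb)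
    (fun b hb => hb.mark (by simpa using hv))

end Build

section Layers

variable {n B : ℕ} {μ : ℕ → ℕ} {E : Fin n × Bool → Fin n × Bool → Prop}

/-- The current matrix is that of `E`, and the cells from `target` on are free for the next one.
Below `B` the memory is that of `μ`. -/
structure Layered (μ : ℕ → ℕ) (B : ℕ) (σ : Store Var)
    (E : Fin n × Bool → Fin n × Bool → Prop) : Prop where
  le_target : B ≤ σ.var .target
  base_le : σ.var .base + 2 * n * (2 * n) ≤ σ.var .target
  matrix : IsMatrix (σ.var .base) σ.mem E
  eqOn : Set.EqOn σ.mem μ (Set.Iio B)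

theorem Layered.setVar (h : Layered μ B σ E) {x : Var} (hx : x ≠ .target) (hx' : x ≠ .base)
    (a : ℕ) : Layered μ B (σ.setVar x a) E :=
  ⟨by simpa [hx.symm] using h.le_target, by simpa [hx.symm, hx'.symm] using h.base_le,
    by simpa [hx'.symm] using h.matrix, h.eqOn⟩

theorem isMatrix_fill {e : Expr Var}
    (he : ∀ (τ : Store Var) (a b : Fin n × Bool), (∀ x, x ≠ .p → x ≠ .q → τ.var x = σ.var x) →
      Set.EqOn τ.mem σ.mem (Set.Iio (σ.var .target)) → τ.var .p = literalIndex a →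
      τ.var .q = literalIndex b → (e.Holds n τ ↔ E a b)) :
    Set.EqOn ((fill e).eval n σ).mem σ.mem (Set.Iio (σ.var .target)) ∧
      IsMatrix (σ.var .target) ((fill e).eval n σ).mem E := by
  have hloop := Cmd.loop_loop_induction (x := .p) (y := .q) (by decide)
    (c := .store (Expr.var .target + position (Expr.var .p) (Expr.var .q)) e)
    (by simp [Cmd.assigned]) (map_literalIndex_literals n) (step := List.cons) (a := []) (σ := σ)
    (R := fun τ (done : List ((Fin n × Bool) × Fin n × Bool)) =>
      Set.EqOn τ.mem σ.mem (Set.Iio (σ.var .target)) ∧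
      ∀ s ∈ done, τ.mem (σ.var .target + entryIndex s.1 s.2) ≠ 0 ↔ E s.1 s.2)
    (fun _ _ _ h => h) (fun _ _ _ h => h) ?_ (by simp [Set.EqOn])
  · rw [List.foldr_cons_nil] at hloop
    exact ⟨hloop.1, fun a b => hloop.2 (a, b) (List.mem_product.2 ⟨mem_literals a, mem_literals b⟩)⟩
  · rintro a b τ done hτ hp hq ⟨heq, hmatrix⟩
    have hvar (x : Var) (hx : x ≠ .p) (hx' : x ≠ .q) : τ.var x = σ.var x :=
      hτ x (by simp [Cmd.assigned]) hx hx'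
    have heval : (Cmd.store (Expr.var .target + position (Expr.var .p) (Expr.var .q)) e).eval n τ =
        τ.setMem (σ.var .target + entryIndex a b) (e.eval n τ) := by
      rw [Cmd.eval, Expr.eval_add, Expr.eval_var, hvar _ (by decide) (by decide),
        eval_position (by simpa using hp) (by simpa using hq)]
    rw [heval]
    refine ⟨fun i hi => ?_, fun s hs => ?_⟩
    · rw [Store.mem_setMem, if_neg ((Set.mem_Iio.1 hi).trans_le (Nat.le_add_right ..)).ne, heq hi]
    · rw [Store.mem_setMem]
      split_ifs with hs'
      · obtain ⟨ha, hb⟩ := entryIndex_inj.1 (Nat.add_left_cancel hs')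
        rw [ha, hb]
        exact he τ a b hvar heq hp hq
      · refine hmatrix s ((List.mem_cons.1 hs).resolve_left ?_)
        rintro rfl
        exact hs' rfl

theorem eval_layer (n : ℕ) (e : Expr Var) (σ : Store Var) :
    (layer e).eval n σ = (((fill e).eval n σ).setVar .base (σ.var .target)).setVar .target
      (σ.var .target + 2 * n * (2 * n)) := by
  have htarget : ((fill e).eval n σ).var .target = σ.var .target :=
    Cmd.var_eval_of_notMem (by simp [fill, Cmd.assigned])
  simp [layer, Cmd.eval, Expr.eval, htarget]

theorem layered_layer {e : Expr Var} (hB : B ≤ σ.var .target)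
    (heqOn : Set.EqOn σ.mem μ (Set.Iio B))
    (he : ∀ (τ : Store Var) (a b : Fin n × Bool), (∀ x, x ≠ .p → x ≠ .q → τ.var x = σ.var x) →
      Set.EqOn τ.mem σ.mem (Set.Iio (σ.var .target)) → τ.var .p = literalIndex a →
      τ.var .q = literalIndex b → (e.Holds n τ ↔ E a b)) :
    Layered μ B ((layer e).eval n σ) E := by
  obtain ⟨heq, hmatrix⟩ := isMatrix_fill he
  rw [eval_layer]
  refine ⟨?_, ?_, ?_, (heq.mono (Set.Iio_subset_Iio hB)).trans heqOn⟩
  · simpa using hB.trans (Nat.le_add_right _ _)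
  · simp
  · simpa using hmatrix

theorem layered_implication (h : Ready I σ) {X S : Finset (Fin I.n)}
    (hX : IsIndicator I.encode.length σ.mem X)
    (hS : IsIndicator (I.encode.length + I.n) σ.mem S) {w w' : Fin I.n} (hw : σ.var .w = w)
    (hw' : σ.var .w' = w') (htarget : σ.var .target = I.encode.length + I.n + I.n) :
    Layered σ.mem (I.encode.length + I.n + I.n) ((layer implication).eval I.n σ)
      (ColouringImplies I.Conflicting X S w w') := by
  refine layered_layer htarget.ge (fun _ _ => rfl) fun τ a b hτ hmem hp hq => ?_
  rw [htarget] at hmem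
  refine holds_implication (h.congr (hτ _ ?_ ?_) (hτ _ ?_ ?_) (hmem.mono ?_))
    (hX.congr (hmem.mono ?_)) (hS.congr hmem) ((hτ _ ?_ ?_).trans hw) ((hτ _ ?_ ?_).trans hw')
    hp hq <;>
  first | decide | exact Set.Iio_subset_Iio (by lia)

theorem Layered.shortcut (h : Layered μ B σ E) {k : Fin n × Bool}
    (hk : σ.var .pivot = literalIndex k) :
    Layered μ B ((layer shortcut).eval n σ) fun a b => E a b ∨ E a k ∧ E k b := by
  refine layered_layer h.le_target h.eqOn fun τ a b hτ hmem hp hq => ?_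
  have hmatrix := h.matrix.congr (hmem.mono (Set.Iio_subset_Iio h.base_le))
  have hbase : τ.var .base = σ.var .base := hτ _ (by decide) (by decide)
  have hk : τ.var .pivot = literalIndex k := (hτ _ (by decide) (by decide)).trans hk
  rw [ConflictFreeCut.shortcut, Expr.holds_or, Expr.holds_and]
  refine or_congr ?_ (and_congr ?_ ?_) <;> refine holds_entry hbase hmatrix ?_ ?_ <;> simpa

theorem layered_closure (h : Ready I σ) {X S : Finset (Fin I.n)}
    (hX : IsIndicator I.encode.length σ.mem X)
    (hS : IsIndicator (I.encode.length + I.n) σ.mem S) {w w' : Fin I.n} (hw : σ.var .w = w)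
    (hw' : σ.var .w' = w') :
    Layered σ.mem (I.encode.length + I.n + I.n) (closure.eval I.n σ)
      (Relation.TransGen (ColouringImplies I.Conflicting X S w w')) := by
  set B := I.encode.length + I.n + I.n
  have htarget : (Expr.var Var.free + Expr.var Var.size + Expr.var Var.size).eval I.n σ = B := by
    simp [B, h.free, h.size]
  have hready : Ready I (σ.setVar .target B) := h.congr (by simp) (by simp) fun _ _ => rfl
  have hwarshall : warshall (ColouringImplies I.Conflicting X S w w') (literals I.n) =
      Relation.TransGen (ColouringImplies I.Conflicting X S w w') :=
    funext₂ fun a b => propext (warshall_iff_transGen mem_literals)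
  rw [closure, Cmd.eval, Cmd.eval, Cmd.eval, htarget, ← hwarshall]
  exact Cmd.loop_induction (map_literalIndex_literals I.n)
    (fun τ _ i h => h.setVar (by decide) (by decide) i) (fun k τ E _ hk hE => hE.shortcut hk)
    (layered_implication hready hX hS (by simpa using hw) (by simpa using hw') (by simp [B]))

end Layers

/-- Some conflict-free colouring with two colours restricts to the subset of `X` to which `u`
guides. -/
def Instance.Admits (I : Instance) (X : Finset (Fin I.n)) (K u : ℕ) : Prop :=
  ∃ w w', Noncontradictory
    (ColouringImplies I.Conflicting X (guidedSubset X (List.finRange I.n) K u) w w')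

open Classical in
theorem eval_trySeparating (h : Ready I σ) {X S : Finset (Fin I.n)}
    (hX : IsIndicator I.encode.length σ.mem X)
    (hS : IsIndicator (I.encode.length + I.n) σ.mem S) {w w' : Fin I.n} (hw : σ.var .w = w)
    (hw' : σ.var .w' = w') :
    Set.EqOn (trySeparating.eval I.n σ).mem σ.mem (Set.Iio (I.encode.length + I.n + I.n)) ∧
      (trySeparating.eval I.n σ).var .answer =
        if Noncontradictory (ColouringImplies I.Conflicting X S w w') then 1
        else σ.var .answer := by
  have hclosure := layered_closure h hX hS hw hw'
  have hsize : (closure.eval I.n σ).var .size = I.n :=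
    (Cmd.var_eval_of_notMem (by decide)).trans h.size
  have hanswer : (closure.eval I.n σ).var .answer = σ.var .answer :=
    Cmd.var_eval_of_notMem (by decide)
  have htest := holds_contradictory hsize rfl hclosure.matrix
  rw [trySeparating, Cmd.eval]
  split_ifs with hN
  · rw [Cmd.eval_ite_of_not_holds (fun hc => htest.1 hc hN)]
    exact ⟨hclosure.eqOn, by simp [Cmd.eval]⟩
  · rw [Cmd.eval_ite_of_holds (htest.2 hN)]
    exact ⟨hclosure.eqOn, hanswer⟩

open Classical in
theorem eval_tryColourings (h : Ready I σ) {X : Finset (Fin I.n)}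
    (hX : IsIndicator I.encode.length σ.mem X) :
    Set.EqOn (tryColourings.eval I.n σ).mem σ.mem (Set.Iio (I.encode.length + I.n)) ∧
      (tryColourings.eval I.n σ).var .answer =
        if I.Admits X (σ.var .budget) (σ.var .code) then 1 else σ.var .answer := by
  set S := guidedSubset X (List.finRange I.n) (σ.var .budget) (σ.var .code) with hS
  have hbuild := builds_buildSubset h hX
  set σ' := buildSubset.eval I.n σ
  have hloop := Cmd.loop_loop_induction (x := .w) (y := .w') (by decide) (c := trySeparating)
    (by decide) (map_val_finRange I.n) (step := List.cons) (a := []) (σ := σ')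
    (R := fun τ (done : List (Fin I.n × Fin I.n)) =>
      Set.EqOn τ.mem σ'.mem (Set.Iio (I.encode.length + I.n + I.n)) ∧
      τ.var .answer = if ∃ s ∈ done, Noncontradictory (ColouringImplies I.Conflicting X S s.1 s.2)
        then 1 else σ.var .answer)
    (fun τ _ i h => by simpa using h) (fun τ _ i h => by simpa using h)
    (fun w w' τ done hτ hw hw' ⟨hmem, hanswer⟩ => ?_)
    ⟨Set.eqOn_refl _ _, by simpa using Cmd.var_eval_of_notMem (by decide)⟩
  · rw [List.foldr_cons_nil] at hloop
    exact ⟨(hloop.1.mono (Set.Iio_subset_Iio (by lia))).trans hbuild.eqOn,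
      hloop.2.trans (if_congr (by simp [Instance.Admits, hS]) rfl rfl)⟩
  · have hmem' := (hmem.mono (Set.Iio_subset_Iio (Nat.le_add_right _ I.n))).trans hbuild.eqOn
    have hvar {x : Var} (hx : x ∉ tryColourings.assigned) (hxw : x ≠ .w) (hxw' : x ≠ .w') :
        τ.var x = σ.var x := by
      simp only [tryColourings, Cmd.assigned, notMem_union] at hx
      exact (hτ x hx.2 hxw hxw').trans (Cmd.var_eval_of_notMem hx.1)
    have hready : Ready I τ := h.congr (hvar (by decide) (by decide) (by decide))
      (hvar (by decide) (by decide) (by decide))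
      (hmem'.mono (Set.Iio_subset_Iio (Nat.le_add_right _ _)))
    obtain ⟨heq, hanswer'⟩ :=
      eval_trySeparating hready (hX.congr hmem') (hbuild.indicator.congr hmem) hw hw'
    refine ⟨heq.trans hmem, ?_⟩
    rw [hanswer', hanswer, ← ite_or]
    simp only [List.exists_mem_cons_iff]
    rfl

/-! ### The program -/

/-- Read off the number of vertices, which the input gives in unary, and make it the size parameter
of the commands that follow. -/
def readSize : Program :=
  .seq (.move (varReg Var.free) 0)
    (.seq ((Cmd.assign Var.flag (.load Var.size)).compile 0)
      (.seq (.loop (varReg Var.flag) ((Cmd.seq (.assign Var.size (Var.size + 1))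
          (.assign Var.flag (.load Var.size))).compile 0))
        (.move 1 (varReg Var.size))))

/-- Proceed to the next code, and double the budget when the codes below it are exhausted. -/
def advance : Cmd Var :=
  .seq (.assign .code (Var.code + 1))
    (.ite (.lt Var.code Var.budget) .skip
      (.seq (.assign .code 0)
        (.seq (.assign .budget (Var.budget + Var.budget)) (.assign .limit (Var.limit + 1)))))

/-- Build the vertex cover for the current code, and clear `flag` if it is small enough. -/
def tryCover : Cmd Var :=
  .seq buildCover (.ite (.lt Var.limit (.sum 1 Var.v (inCover Var.v))) advance (.assign .flag 0))

/-- Find a vertex cover of minimum size `limit`, and put `2 ^ limit` into `budget`. -/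
def findCover : Program :=
  .seq ((Cmd.seq (.assign Var.budget 1) (.assign Var.flag 1)).compile 0)
    (.loop (varReg Var.flag) (tryCover.compile 0))

/-- Put into `answer` whether some colouring of the vertex cover extends to a conflict-free
colouring with two colours. -/
def findColouring : Program :=
  .seq ((Cmd.assign Var.code Var.budget).compile 0)
    (.loop (varReg Var.code)
      ((Cmd.seq (.assign Var.code (Var.code - 1)) tryColourings).compile 0))

/-- The algorithm: the answer depends on the colouring of a minimum vertex cover. -/
def program : Program :=
  .seq readSize (.seq findCover (.seq findColouring (.move 0 (varReg Var.answer))))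

/-- The invariant of the loop that reads off the number of vertices. -/
structure Reading (I : Instance) (σ : Store Var) : Prop where
  free : σ.var .free = I.encode.length
  size_le : σ.var .size ≤ I.n
  flag : σ.var .flag = σ.mem (σ.var .size)
  input : I.IsInput σ.mem
  limit : σ.var .limit = 0
  code : σ.var .code = 0
  answer : σ.var .answer = 0

theorem Reading.step (h : Reading I σ) (hflag : σ.var .flag ≠ 0) :
    Reading I (((σ.setVar .size (σ.var .size + 1))).setVar .flag (σ.mem (σ.var .size + 1))) := by
  refine ⟨by simpa using h.free, ?_, by simp, h.input, by simpa using h.limit,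
    by simpa using h.code, by simpa using h.answer⟩
  have hne : σ.var .size ≠ I.n := fun hn => by
    rw [h.flag, hn, h.input.ne_zero_iff I.getElem?_encode_n] at hflag
    exact Bool.false_ne_true hflag
  simpa using h.size_le.lt_of_ne hne

theorem Reading.size_eq (h : Reading I σ) (hflag : σ.var .flag = 0) : σ.var .size = I.n := by
  by_contra hne
  exact (h.input.ne_zero_iff (I.getElem?_encode_of_lt (h.size_le.lt_of_ne hne))).2 rfl
    (h.flag ▸ hflag)

/-- The store before the search for a vertex cover. -/
structure Fresh (I : Instance) (σ : Store Var) : Prop extends Ready I σ where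
  limit : σ.var .limit = 0
  code : σ.var .code = 0
  answer : σ.var .answer = 0

theorem exists_readSize_ensures : ∃ p : ℕ[X], ∀ I : Instance,
    readSize.Ensures (State.start I.encode) (p.eval I.n)
      fun s => ∃ σ, Represents I.n s σ ∧ Fresh I σ := by
  set load : Cmd Var := .assign .flag (.load Var.size)
  set step : Cmd Var := .seq (.assign .size (Var.size + 1)) load
  refine ⟨2 + (C (load.cost.eval 0) + (X * (C (step.cost.eval 0) + 1) + 1 + 2)), fun I => ?_⟩
  simp only [eval_add, eval_mul, eval_X, eval_C, eval_ofNat, eval_one]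
  set σ : Store Var :=
    ⟨fun x => if x = .free then I.encode.length else 0, (State.start I.encode).mem⟩
  refine .seq (Q := fun s => Represents 0 s σ)
    (Program.move_ensures (by simp [varReg]) ⟨rfl, fun x => ?_, rfl⟩) fun s h => ?_
  · by_cases hx : x = .free
    · simp [hx, σ, State.start]
    · simp [hx, σ, State.start, varReg]
  · have hstart : Reading I (load.eval 0 σ) := by
      constructor <;> simp [load, Cmd.eval, σ, Instance.IsInput, Set.eqOn_refl]
    refine (load.ensures h).seq fun s h => ?_
    refine (step.while_ensures .flag (I := Reading I) (fun σ => I.n - σ.var .size)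
      (fun τ hτ hflag => ?_) h hstart (Nat.sub_le _ _)).seq fun s ⟨τ, h, hτ, hflag⟩ => ?_
    · have hstep : step.eval 0 τ =
          (τ.setVar .size (τ.var .size + 1)).setVar .flag (τ.mem (τ.var .size + 1)) := by
        simp [step, load, Cmd.eval]
      have hsize := (hτ.step hflag).size_le
      rw [hstep]
      refine ⟨hτ.step hflag, ?_⟩
      simp only [Store.var_setVar, if_true, reduceCtorEq, if_false] at hsize ⊢
      lia
    · refine Program.move_ensures (one_ne_varReg _).symm ?_
      rw [h.var, hτ.size_eq hflag]
      exact ⟨τ, h.setSize _, ⟨hτ.free, hτ.size_eq hflag, hτ.input⟩, hτ.limit, hτ.code, hτ.answer⟩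

theorem eval_advance (n : ℕ) (σ : Store Var) :
    advance.eval n σ = if σ.var .code + 1 < σ.var .budget then σ.setVar .code (σ.var .code + 1)
      else ((σ.setVar .code 0).setVar .budget (σ.var .budget + σ.var .budget)).setVar .limit
        (σ.var .limit + 1) := by
  rw [advance, Cmd.eval]
  split_ifs with h
  · rw [Cmd.eval_ite_of_holds (by simpa [Cmd.eval] using h)]
    simp [Cmd.eval]
  · rw [Cmd.eval_ite_of_not_holds (by simpa [Cmd.eval] using h)]
    simp [Cmd.eval]

theorem eval_sum_inCover {X : Finset (Fin I.n)} (h : Ready I σ)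
    (hX : IsIndicator I.encode.length σ.mem X) :
    (Expr.sum 1 Var.v (inCover Var.v)).eval I.n σ = X.card := by
  rw [Expr.eval, one_mul, ← hX.sum_eq_card]
  simp [inCover, h.free]

/-- The invariant of the search for a vertex cover. The codes are numbered by `budget + code`, and
`N` is a number that the search does not exceed. -/
structure Searching (I : Instance) (N : ℕ) (σ : Store Var) : Prop extends Ready I σ where
  budget : σ.var .budget = 2 ^ σ.var .limit
  code_lt : σ.var .code < σ.var .budget
  le : σ.var .budget + σ.var .code ≤ N
  answer : σ.var .answer = 0

/-- The memory holds the vertex cover `X`, and its size is at most `limit`. -/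
structure HoldsCover (I : Instance) (σ : Store Var) (X : Finset (Fin I.n)) : Prop where
  isVertexCover : I.G.IsVertexCover X
  card_le : X.card ≤ σ.var .limit
  indicator : IsIndicator I.encode.length σ.mem X

namespace Searching

variable {N k u : ℕ}

theorem congr (h : Searching I N σ)
    (hvar : ∀ x ∈ ({.free, .size, .limit, .budget, .code, .answer} : Finset Var),
      τ.var x = σ.var x)
    (hmem : Set.EqOn τ.mem σ.mem (Set.Iio I.encode.length)) : Searching I N τ := by
  refine ⟨h.toReady.congr (hvar _ (by decide)) (hvar _ (by decide)) hmem, ?_, ?_, ?_,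
    (hvar _ (by decide)).trans h.answer⟩
  · rw [hvar .budget (by decide), hvar .limit (by decide), h.budget]
  · rw [hvar .code (by decide), hvar .budget (by decide)]
    exact h.code_lt
  · rw [hvar .code (by decide), hvar .budget (by decide)]
    exact h.le

theorem limit_eq_log (h : Searching I N σ) :
    σ.var .limit = Nat.log 2 (σ.var .budget + σ.var .code) := by
  have hlt := h.code_lt
  rw [h.budget] at hlt ⊢
  exact (Nat.log_eq_of_pow_le_of_lt_pow (by lia) (by rw [pow_succ]; lia)).symm

theorem limit_le (h : Searching I (2 ^ k + u) σ) (hu : u < 2 ^ k) : σ.var .limit ≤ k := by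
  rw [h.limit_eq_log]
  exact Nat.lt_succ_iff.1 (Nat.log_lt_of_lt_pow (by have := h.code_lt; lia)
    (h.le.trans_lt (by rw [pow_succ]; lia)))

theorem eq_of_budget_add_code_eq (h : Searching I (2 ^ k + u) σ) (hu : u < 2 ^ k)
    (heq : σ.var .budget + σ.var .code = 2 ^ k + u) :
    σ.var .limit = k ∧ σ.var .budget = 2 ^ k ∧ σ.var .code = u := by
  have hlimit : σ.var .limit = k := by
    rw [h.limit_eq_log, heq]
    exact Nat.log_eq_of_pow_le_of_lt_pow (by lia) (by rw [pow_succ]; lia)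
  have hbudget := h.budget
  rw [hlimit] at hbudget
  exact ⟨hlimit, hbudget, by lia⟩

theorem eval_advance (h : Searching I N σ) (hlt : σ.var .budget + σ.var .code < N) :
    Searching I N (advance.eval I.n σ) ∧
      σ.var .budget + σ.var .code <
        (advance.eval I.n σ).var .budget + (advance.eval I.n σ).var .code := by
  have hcode := h.code_lt
  rw [ConflictFreeCut.eval_advance]
  split_ifs with hc
  · refine ⟨⟨h.toReady.congr ?_ ?_ fun _ _ => rfl, ?_, ?_, ?_, ?_⟩, ?_⟩ <;>
      simp [h.answer, h.budget]
    · simpa [h.budget] using hc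
    · simpa [h.budget, add_assoc] using Nat.succ_le_of_lt hlt
  · refine ⟨⟨h.toReady.congr ?_ ?_ fun _ _ => rfl, ?_, ?_, ?_, ?_⟩, ?_⟩ <;>
      simp [h.answer, h.budget]
    · ring
    · rw [h.budget] at hlt hcode hc
      lia
    · rwa [h.budget] at hcode

theorem eval_tryCover (h : Searching I (2 ^ k + u) σ) (hu : u < 2 ^ k)
    (hcard : (guidedCover I.G (List.finRange I.n) (2 ^ k) u).card ≤ k) :
    Searching I (2 ^ k + u) (tryCover.eval I.n σ) ∧
      ((tryCover.eval I.n σ).var .flag = 0 ∧ (∃ X, HoldsCover I (tryCover.eval I.n σ) X) ∧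
          (tryCover.eval I.n σ).var .budget + (tryCover.eval I.n σ).var .code =
            σ.var .budget + σ.var .code ∨
        (tryCover.eval I.n σ).var .flag = σ.var .flag ∧ σ.var .budget + σ.var .code <
          (tryCover.eval I.n σ).var .budget + (tryCover.eval I.n σ).var .code) := by
  set X := guidedCover I.G (List.finRange I.n) (σ.var .budget) (σ.var .code) with hX
  have hbuild := builds_buildCover h.toReady
  have hvar : ∀ x ∉ buildCover.assigned, (buildCover.eval I.n σ).var x = σ.var x :=
    fun x hx => Cmd.var_eval_of_notMem hx
  have hsearch : Searching I (2 ^ k + u) (buildCover.eval I.n σ) :=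
    h.congr (fun x hx => hvar x (by decide +revert)) hbuild.eqOn
  have htest : (Expr.lt Var.limit (.sum 1 Var.v (inCover Var.v))).Holds I.n
      (buildCover.eval I.n σ) ↔ σ.var .limit < X.card := by
    rw [Expr.holds_lt, eval_sum_inCover hsearch.toReady hbuild.indicator, Expr.eval_var,
      hvar _ (by decide)]
    rfl
  rw [tryCover, Cmd.eval]
  by_cases hc : σ.var .limit < X.card
  · rw [Cmd.eval_ite_of_holds (htest.2 hc)]
    have hne : σ.var .budget + σ.var .code ≠ 2 ^ k + u := fun heq => by
      obtain ⟨hlimit, hbudget, hcode⟩ := h.eq_of_budget_add_code_eq hu heq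
      rw [hX, hlimit, hbudget, hcode] at hc
      exact hcard.not_gt hc
    have hadvance := hsearch.eval_advance
    rw [hvar .budget (by decide), hvar .code (by decide)] at hadvance
    specialize hadvance (h.le.lt_of_ne hne)
    refine ⟨hadvance.1, .inr ⟨?_, hadvance.2⟩⟩
    rw [Cmd.var_eval_of_notMem (by decide), hvar _ (by decide)]
  · rw [Cmd.eval_ite_of_not_holds (mt htest.1 hc)]
    refine ⟨hsearch.congr (by simp [Cmd.eval]) fun _ _ => rfl,
      .inl ⟨by simp [Cmd.eval], ⟨X, ?_, ?_, hbuild.indicator⟩, ?_⟩⟩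
    · exact isVertexCover_guidedCover List.mem_finRange _ _
    · simpa [Cmd.eval, hvar .limit (by decide)] using hc
    · simp [Cmd.eval, hvar .budget (by decide), hvar .code (by decide)]

end Searching

theorem exists_findCover_ensures : ∃ p : ℕ[X], ∀ (I : Instance) (s : State) (σ : Store Var),
    Represents I.n s σ → Fresh I σ →
      findCover.Ensures s (2 ^ I.vertexCoverNumber * p.eval I.n) fun s' => ∃ τ X N,
        Represents I.n s' τ ∧ Searching I N τ ∧ τ.var .limit ≤ I.vertexCoverNumber ∧
          HoldsCover I τ X := by
  set start : Cmd Var := .seq (.assign .budget 1) (.assign .flag 1)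
  refine ⟨start.cost + (2 * (tryCover.cost + 1) + 1), fun I s σ h hσ => ?_⟩
  set k := I.vertexCoverNumber
  obtain ⟨C, hC, hcard⟩ := I.exists_isVertexCover_card_eq
  obtain ⟨u, hu, hu'⟩ := exists_card_guidedCover_le hC hcard.le (List.finRange I.n)
  have hstart : Searching I (2 ^ k + u) (start.eval I.n σ) := by
    have hle : 1 ≤ 2 ^ k + u := Nat.one_le_two_pow.trans (Nat.le_add_right _ _)
    refine ⟨hσ.toReady.congr ?_ ?_ fun _ _ => rfl, ?_, ?_, ?_, ?_⟩ <;>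
      simp [start, Cmd.eval, hσ.limit, hσ.code, hσ.answer, hle]
  refine ((start.ensures h).seq fun s' h' => tryCover.while_ensures .flag
    (I := fun τ => Searching I (2 ^ k + u) τ ∧ τ.var .flag ≤ 1 ∧
      (τ.var .flag = 0 → ∃ X, HoldsCover I τ X))
    (fun τ => τ.var .flag + (2 ^ k + u - (τ.var .budget + τ.var .code)))
    (N := 2 * 2 ^ k) (fun τ ⟨hτ, _, _⟩ hflag => ?_) h' ⟨hstart, ?_, ?_⟩ ?_).mono ?_ ?_
  · have := hτ.le
    obtain ⟨hτ', ⟨hflag', hX, heq⟩ | ⟨hflag', hlt⟩⟩ := hτ.eval_tryCover hu hu'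
    · exact ⟨⟨hτ', by lia, fun _ => hX⟩, by lia⟩
    · exact ⟨⟨hτ', by lia, fun h0 => absurd (hflag'.symm.trans h0) hflag⟩, by have := hτ'.le; lia⟩
  · simp [start, Cmd.eval]
  · simp [start, Cmd.eval]
  · suffices 1 + (2 ^ k + u - 1) ≤ 2 * 2 ^ k by simpa [start, Cmd.eval, hσ.code]
    lia
  · simp only [eval_add, eval_mul, eval_ofNat, eval_one]
    nlinarith [Nat.one_le_two_pow (n := k)]
  · rintro s' ⟨τ, h', ⟨hτ, -, hfound⟩, hflag⟩
    obtain ⟨X, hX⟩ := hfound hflag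
    exact ⟨τ, X, _, h', hτ, hτ.limit_le hu, hX⟩

/-- The invariant of the search for a colouring. The codes from `code` on have been tried. -/
structure Colouring (I : Instance) (X : Finset (Fin I.n)) (K : ℕ) (σ : Store Var) : Prop
    extends Ready I σ where
  indicator : IsIndicator I.encode.length σ.mem X
  budget : σ.var .budget = K
  code_le : σ.var .code ≤ K
  answer_le : σ.var .answer ≤ 1
  answer_eq : σ.var .answer = 1 ↔ ∃ u, σ.var .code ≤ u ∧ u < K ∧ I.Admits X K u

theorem Colouring.step {X : Finset (Fin I.n)} {K : ℕ} (h : Colouring I X K σ)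
    (hcode : σ.var .code ≠ 0) :
    Colouring I X K (tryColourings.eval I.n (σ.setVar .code (σ.var .code - 1))) ∧
      (tryColourings.eval I.n (σ.setVar .code (σ.var .code - 1))).var .code =
        σ.var .code - 1 := by
  classical
  set τ := σ.setVar .code (σ.var .code - 1)
  have hready : Ready I τ := h.toReady.congr (by simp [τ]) (by simp [τ]) fun _ _ => rfl
  obtain ⟨hmem, hanswer⟩ := eval_tryColourings hready h.indicator
  have hvar {x : Var} (hx : x ∉ tryColourings.assigned) (hx' : x ≠ .code) :
      (tryColourings.eval I.n τ).var x = σ.var x :=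
    (Cmd.var_eval_of_notMem hx).trans (by simp [τ, hx'])
  have hcode' : (tryColourings.eval I.n τ).var .code = σ.var .code - 1 :=
    (Cmd.var_eval_of_notMem (by decide)).trans (by simp [τ])
  have hinput : Set.EqOn (tryColourings.eval I.n τ).mem σ.mem (Set.Iio I.encode.length) :=
    hmem.mono (Set.Iio_subset_Iio (Nat.le_add_right _ _))
  simp only [τ, Store.var_setVar, if_true, reduceCtorEq, if_false, h.budget] at hanswer
  have hle := h.code_le
  refine ⟨⟨h.toReady.congr (hvar (by decide) (by decide)) (hvar (by decide) (by decide)) hinput,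
    h.indicator.congr hmem, (hvar (by decide) (by decide)).trans h.budget, by lia, ?_, ?_⟩, hcode'⟩
  · rw [hanswer]
    split_ifs
    exacts [le_rfl, h.answer_le]
  · rw [hanswer, hcode', ite_eq_left_iff]
    constructor
    · intro ha
      by_cases hadmits : I.Admits X K (σ.var .code - 1)
      · exact ⟨_, le_rfl, by lia, hadmits⟩
      · obtain ⟨u, hu, hu'⟩ := h.answer_eq.1 (ha hadmits)
        exact ⟨u, by lia, hu'⟩
    · rintro ⟨u, hu, hu', hadmits⟩ hnot
      refine h.answer_eq.2 ⟨u, ?_, hu', hadmits⟩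
      by_contra hlt
      exact hnot ((show σ.var .code - 1 = u by lia) ▸ hadmits)

theorem exists_findColouring_ensures : ∃ p : ℕ[X], ∀ (I : Instance) (s : State) (σ : Store Var)
    (X : Finset (Fin I.n)) (N : ℕ), Represents I.n s σ → Searching I N σ →
      σ.var .limit ≤ I.vertexCoverNumber → HoldsCover I σ X →
      findColouring.Ensures s (2 ^ I.vertexCoverNumber * p.eval I.n) fun s' => ∃ τ,
        Represents I.n s' τ ∧ τ.var Var.answer ≤ 1 ∧
          (τ.var Var.answer = 1 ↔ I.HasConflictFreeCut) := by
  set start : Cmd Var := .assign .code Var.budget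
  set step : Cmd Var := .seq (.assign .code (Var.code - 1)) tryColourings
  refine ⟨start.cost + (step.cost + 1 + 1), fun I s σ X N h hσ hlimit hX => ?_⟩
  set k := I.vertexCoverNumber
  have hpow : 2 ^ σ.var .limit ≤ 2 ^ k := Nat.pow_le_pow_right two_pos hlimit
  have hstart : Colouring I X (2 ^ σ.var .limit) (start.eval I.n σ) := by
    refine ⟨hσ.toReady.congr ?_ ?_ fun _ _ => rfl, hX.indicator, ?_, ?_, ?_, ?_⟩ <;>
      simp +contextual [start, Cmd.eval, hσ.budget, hσ.answer, not_lt_of_ge]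
  refine ((start.ensures h).seq fun s' h' => step.while_ensures .code
    (I := Colouring I X (2 ^ σ.var .limit)) (fun τ => τ.var .code) (fun τ hτ hcode => ?_)
    h' hstart (hstart.code_le.trans hpow)).mono ?_ ?_
  · obtain ⟨hτ', hcode'⟩ := hτ.step hcode
    exact ⟨hτ', hcode'.trans_lt (Nat.sub_one_lt hcode)⟩
  · simp only [eval_add, eval_one]
    nlinarith [Nat.one_le_two_pow (n := k)]
  · rintro s' ⟨τ, h', hτ, hcode⟩
    refine ⟨τ, h', hτ.answer_le, ?_⟩
    rw [hτ.answer_eq, hcode,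
      I.hasConflictFreeCut_iff_exists_guidedSubset hX.isVertexCover hX.card_le]
    simp [Instance.Admits]

theorem exists_program_decidesInTime : ∃ p : ℕ[X], program.DecidesInTime Instance.encode
    Instance.HasConflictFreeCut fun I => 2 ^ I.vertexCoverNumber * p.eval I.n := by
  obtain ⟨p, hp⟩ := exists_readSize_ensures
  obtain ⟨p', hp'⟩ := exists_findCover_ensures
  obtain ⟨p'', hp''⟩ := exists_findColouring_ensures
  refine ⟨p + (p' + (p'' + 2)), fun I => ?_⟩
  have hprogram : program.Ensures (State.start I.encode)
      (p.eval I.n + (2 ^ I.vertexCoverNumber * p'.eval I.n +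
        (2 ^ I.vertexCoverNumber * p''.eval I.n + 2)))
      fun s => s.reg 0 ≤ 1 ∧ (s.reg 0 = 1 ↔ I.HasConflictFreeCut) := by
    refine (hp I).seq fun s ⟨σ, h, hσ⟩ => (hp' I s σ h hσ).seq
      fun s ⟨σ, X, N, h, hσ, hlimit, hX⟩ => (hp'' I s σ X N h hσ hlimit hX).seq
      fun s ⟨σ, h, hanswer⟩ => Program.move_ensures (by simp [varReg]) ?_
    rwa [State.reg_setReg_self, h.var]
  obtain ⟨s, t, hrun, ht, hle, hiff⟩ := hprogram
  refine ⟨s, t, hrun, ht.trans ?_, hiff.2, fun hnot => ?_⟩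
  · simp only [eval_add, eval_ofNat]
    nlinarith [Nat.one_le_two_pow (n := I.vertexCoverNumber)]
  · have := mt hiff.1 hnot
    lia

theorem computable_two_pow : Computable fun k : ℕ => 2 ^ k := by
  refine Primrec.to_comp ((Primrec.nat_rec₁ 1 (Primrec.nat_mul.comp
    (Primrec.const 2) Primrec.snd).to₂).of_eq fun k => ?_)
  induction k with
  | zero => rfl
  | succ k ih => rw [pow_succ, mul_comm, ← ih]

theorem eval_mono (p : ℕ[X]) {a b : ℕ} (h : a ≤ b) : p.eval a ≤ p.eval b := by
  rw [eval_eq_sum, eval_eq_sum]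
  exact Finset.sum_le_sum fun i _ => Nat.mul_le_mul_left _ (Nat.pow_le_pow_left h i)

end ConflictFreeCut

/-- Conflict-Free Cut is fixed-parameter tractable with the vertex cover number `k` of the input
graph as the parameter; it can be decided in time `2 ^ k * n ^ O(1)`, where `n` is the number of
vertices of the input graph. -/
theorem theorem2 :
    FixedParameterTractable ConflictFreeCut.Instance.encode
      ConflictFreeCut.Instance.HasConflictFreeCut
      ConflictFreeCut.Instance.vertexCoverNumber ∧
    ∃ (P : RAM.Program) (p : Polynomial ℕ),
      P.DecidesInTime ConflictFreeCut.Instance.encode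
        ConflictFreeCut.Instance.HasConflictFreeCut
        (fun I => 2 ^ I.vertexCoverNumber * p.eval I.n) := by
  obtain ⟨p, hp⟩ := ConflictFreeCut.exists_program_decidesInTime
  refine ⟨⟨_, p, ConflictFreeCut.program, ConflictFreeCut.computable_two_pow, fun I => ?_⟩,
    ConflictFreeCut.program, p, hp⟩
  obtain ⟨s, t, hrun, ht, hs⟩ := hp I
  have hn : I.n ≤ I.encode.length := by
    rw [I.length_encode]
    lia
  exact ⟨s, t, hrun, ht.trans (Nat.mul_le_mul_left _ (ConflictFreeCut.eval_mono p hn)), hs⟩
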